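/- Let $G$ be a finite simple undirected graph with at least $6$ vertices that is $3$-connected, i.e. $G$ has more than $3$ vertices and deleting any set of at most $2$ vertices leaves a connected graph. Then $G$ contains two cycles of consecutive even lengths: there is an integer $m$ such that $G$ contains a cycle of length $2m$ and a cycle of length $2m+2$ (the length of a cycle being its number of edges). -/

import Mathlib

/-- A finite graph is `k`-connected if it has more than `k` vertices and deleting any set of fewer
than `k` vertices leaves a connected graph. -/
def SimpleGraph.IsKConnected {V : Type*} [Fintype V] (G : SimpleGraph V) (k : ℕ) : Prop :=
  k < Fintype.card V ∧
    ∀ S : Finset V, S.card < k → (G.induce {v : V | v ∉ S}).Connected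

/-- `G` contains two cycles of consecutive even lengths `2 * m` and `2 * m + 2`. The length of a
cycle is its number of edges; a closed walk that `IsCycle` has length at least 3. -/
def SimpleGraph.HasConsecutiveEvenCycles {V : Type*} (G : SimpleGraph V) : Prop :=
  ∃ (m : ℕ) (u v : V) (C : G.Walk u u) (C' : G.Walk v v),
    C.IsCycle ∧ C'.IsCycle ∧ C.length = 2 * m ∧ C'.length = 2 * m + 2

/-! The engine is `PathIn.win`: two routes between `x` and `y` whose lengths differ by two, closed
by a third path of the right parity, are two cycles of consecutive even lengths. On a cycle of
length `2s`, positions `i` and `i + s + 1` cut arcs of lengths `s + 1` and `s - 1`, so it suffices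
to join them outside the cycle by a path of suitable parity.

To make such paths available, `exists_even_complement` takes a connected set disjoint from some even
cycle and enlarges it to a maximal connected `K` with an even cycle left in its complement. By
maximality every even cycle avoiding `K` contains all vertices attached to `K`. Together with
3-connectivity this forces the complement of `K` to be a single even cycle, all of it attached to
`K` (up to one vertex of a 4-cycle), unless the conclusion already holds.

If `G` has no odd cycle, parity is automatic and `K` may grow from one vertex (`win_of_bipartite`).
If an odd cycle is disjoint from an even one, `K` grows from the odd cycle, which supplies paths of
both parities; only a 2-separation could prevent their use (`win_of_disjoint`).

Otherwise take a shortest odd cycle `v`. If its complement is acyclic, `v` must be a triangle, and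
leaves of the forest give cycles of lengths 4 and 6 (`win_of_triangle_acyclic`). If not, the
complement contains an odd cycle `w`, no even cycle is disjoint from either, and `v` and `w` cover
the graph (`OddPair.cover`). The edges between them yield the cycles, again mostly of lengths 4 and
6 (`OddPair.win_of_triangle`, `OddPair.win_of_five_le`). -/

namespace SimpleGraph

variable {V : Type*} {G : SimpleGraph V}

/-! ### Paths and cycles as injective vertex sequences inside a set -/

/-- There is a path of length `n` from `x` to `y` all of whose vertices lie in `S`. -/
def PathIn (G : SimpleGraph V) (S : Set V) (x y : V) (n : ℕ) : Prop :=
  ∃ q : ℕ → V, q 0 = x ∧ q n = y ∧ (∀ i < n, G.Adj (q i) (q (i + 1))) ∧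
    (∀ i ≤ n, ∀ j ≤ n, q i = q j → i = j) ∧ ∀ i ≤ n, q i ∈ S

/-- `S` contains a cycle of length `n`. -/
def CycIn (G : SimpleGraph V) (S : Set V) (n : ℕ) : Prop :=
  3 ≤ n ∧ ∃ x y, G.Adj y x ∧ G.PathIn S x y (n - 1)

/-- `v` runs periodically through the vertices of a cycle of length `n`. -/
structure IsCyc (G : SimpleGraph V) (n : ℕ) (v : ℤ → V) : Prop where
  three_le : 3 ≤ n
  period : ∀ i, v (i + n) = v i
  adj : ∀ i, G.Adj (v i) (v (i + 1))
  inj : ∀ i j, v i = v j → i < j + n → j < i + n → i = j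

/-- `y` can be reached from `x` by a walk inside `S`. -/
def Reach (G : SimpleGraph V) (S : Set V) (x y : V) : Prop :=
  x ∈ S ∧ Relation.ReflTransGen (fun a b => G.Adj a b ∧ b ∈ S) x y

/-- The set `S` induces a preconnected subgraph. -/
def ConnOn (G : SimpleGraph V) (S : Set V) : Prop :=
  ∀ x ∈ S, ∀ y ∈ S, G.Reach S x y

/-- Two cycles of consecutive even lengths. -/
def Win (G : SimpleGraph V) : Prop :=
  ∃ m, G.CycIn Set.univ (2 * m) ∧ G.CycIn Set.univ (2 * m + 2)

namespace PathIn

variable {S T : Set V} {x y z w : V} {m n : ℕ}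

theorem mono (h : G.PathIn S x y n) (hST : S ⊆ T) : G.PathIn T x y n := by
  obtain ⟨q, h0, hn, ha, hi, hS⟩ := h
  exact ⟨q, h0, hn, ha, hi, fun i hi => hST (hS i hi)⟩

theorem left_mem (h : G.PathIn S x y n) : x ∈ S := by
  obtain ⟨q, h0, hn, ha, hi, hS⟩ := h
  exact h0 ▸ hS 0 (Nat.zero_le _)

theorem symm (h : G.PathIn S x y n) : G.PathIn S y x n := by
  obtain ⟨q, h0, hn, ha, hi, hS⟩ := h
  refine ⟨fun i => q (n - i), by simpa using hn, by simpa using h0, fun i hin => ?_, ?_, ?_⟩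
  · have := ha (n - (i + 1)) (by omega)
    rw [show n - (i + 1) + 1 = n - i by omega] at this
    exact this.symm
  · intro i hi' j hj' hij
    have := hi (n - i) (by omega) (n - j) (by omega) hij
    omega
  · exact fun i _ => hS _ (by omega)

theorem single (hx : x ∈ S) : G.PathIn S x x 0 :=
  ⟨fun _ => x, rfl, rfl, by omega, by intros; omega, fun _ _ => hx⟩

theorem join (h : G.PathIn S x y m) (hyz : G.Adj y z) (h' : G.PathIn T z w n)
    (hd : ∀ u, u ∈ S → u ∈ T → False) : G.PathIn (S ∪ T) x w (m + 1 + n) := by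
  obtain ⟨q, h0, hn, ha, hi, hS⟩ := h
  obtain ⟨r, h0', hn', ha', hi', hS'⟩ := h'
  refine ⟨fun i => if i ≤ m then q i else r (i - (m + 1)), by simpa using h0, ?_, ?_, ?_, ?_⟩
  · simp only [show ¬ (m + 1 + n ≤ m) by omega, if_false]
    rw [show m + 1 + n - (m + 1) = n by omega, hn']
  · intro i hin
    rcases lt_trichotomy i m with h | h | h
    · simpa [h.le, Nat.succ_le_of_lt h] using ha i h
    · subst h
      simpa [hn, h0'] using hyz
    · simp only [show ¬ i ≤ m by omega, show ¬ i + 1 ≤ m by omega, if_false]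
      have := ha' (i - (m + 1)) (by omega)
      rwa [show i - (m + 1) + 1 = i + 1 - (m + 1) by omega] at this
  · intro i hi1 j hj1 hij
    dsimp only at hij
    split_ifs at hij with h1 h2 h2
    · exact hi i h1 j h2 hij
    · exact (hd _ (hS i h1) (hij ▸ hS' _ (by omega))).elim
    · exact (hd _ (hS j h2) (hij ▸ hS' _ (by omega))).elim
    · have := hi' _ (by omega) _ (by omega) hij
      omega
  · intro i hi1
    dsimp only
    split_ifs with h1
    · exact Or.inl (hS i h1)
    · exact Or.inr (hS' _ (by omega))

theorem cons (hxy : G.Adj x y) (h : G.PathIn S y z n) (hx : x ∉ S) :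
    G.PathIn (insert x S) x z (n + 1) := by
  have := join (single (G := G) (Set.mem_singleton x)) hxy h
    (by rintro u rfl hu; exact hx hu)
  rw [show 0 + 1 + n = n + 1 by omega] at this
  rwa [Set.insert_eq]

theorem snoc (h : G.PathIn S x y n) (hyz : G.Adj y z) (hz : z ∉ S) :
    G.PathIn (insert z S) x z (n + 1) :=
  (cons hyz.symm h.symm hz).symm

theorem uncons (h : G.PathIn S x y (n + 1)) :
    ∃ z, G.Adj x z ∧ G.PathIn (S \ {x}) z y n := by
  obtain ⟨q, h0, hn, ha, hi, hS⟩ := h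
  refine ⟨q 1, h0 ▸ ha 0 (by omega), fun i => q (i + 1), rfl, hn, fun i hi => ha _ (by omega), ?_, ?_⟩
  · intro i h1 j h2 h3
    have := hi _ (by omega) _ (by omega) h3
    omega
  · intro i h1
    refine ⟨hS _ (by omega), fun h => ?_⟩
    have := hi (i + 1) (by omega) 0 (by omega) (h.trans h0.symm)
    omega

theorem eq_of_zero (h : G.PathIn S x y 0) : x = y := by
  obtain ⟨q, h0, hn, -⟩ := h
  exact h0.symm.trans hn

theorem append (h : G.PathIn S x y m) (h' : G.PathIn T y z n)
    (hd : ∀ u, u ∈ S → u ∈ T → u = y) : G.PathIn (S ∪ T) x z (m + n) := by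
  cases n with
  | zero =>
    obtain rfl := h'.eq_of_zero
    exact h.mono Set.subset_union_left
  | succ n =>
    obtain ⟨w, hw, hp⟩ := h'.uncons
    have := h.join hw hp (fun u h1 h2 => h2.2 (hd u h1 h2.1))
    rw [show m + 1 + n = m + (n + 1) by omega] at this
    exact this.mono (Set.union_subset_union_right _ Set.sdiff_subset)

theorem ends (h : G.PathIn S z w n) (hx : G.Adj x z) (hy : G.Adj y w) (hxy : x ≠ y)
    (hxS : x ∉ S) (hyS : y ∉ S) : G.PathIn (insert x (insert y S)) x y (n + 2) :=
  cons hx (snoc h hy.symm hyS) (by simp [hxy, hxS])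

theorem pos_of_ne (h : G.PathIn S x y n) (hn : x ≠ y) : 0 < n := by
  rcases Nat.eq_zero_or_pos n with rfl | h'
  · exact (hn h.eq_of_zero).elim
  · exact h'

theorem close (h : G.PathIn S x y m) (h' : G.PathIn T x y n)
    (hd : ∀ u, u ∈ S → u ∈ T → u = x ∨ u = y) (hn : 0 < n) (hmn : 3 ≤ m + n) :
    G.CycIn (S ∪ T) (m + n) := by
  obtain ⟨n, rfl⟩ : ∃ k, n = k + 1 := ⟨n - 1, by omega⟩
  obtain ⟨z, hz, hp⟩ := h'.uncons
  refine ⟨hmn, x, z, hz.symm, ?_⟩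
  have := h.append hp.symm (fun u h1 h2 => (hd u h1 h2.1).resolve_left h2.2)
  exact (this.mono (Set.union_subset_union_right _ Set.sdiff_subset))

end PathIn

theorem CycIn.mono {S T : Set V} {n : ℕ} (h : G.CycIn S n) (hST : S ⊆ T) : G.CycIn T n := by
  obtain ⟨h3, x, y, ha, hp⟩ := h
  exact ⟨h3, x, y, ha, hp.mono hST⟩

theorem PathIn.closeAdj {S : Set V} {x y : V} {n : ℕ} (h : G.PathIn S x y n) (ha : G.Adj x y)
    (hn : 2 ≤ n) : G.CycIn S (n + 1) :=
  ⟨by omega, x, y, ha.symm, by simpa using h⟩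

theorem win_of_cyc {S T : Set V} {a b : ℕ} (h : G.CycIn S a) (h' : G.CycIn T b) (hab : b = a + 2)
    (ha : a % 2 = 0) : G.Win := by
  refine ⟨a / 2, ?_, ?_⟩
  · rw [show 2 * (a / 2) = a by omega]; exact h.mono (Set.subset_univ _)
  · rw [show 2 * (a / 2) + 2 = b by omega]; exact h'.mono (Set.subset_univ _)

/-- The two routes in `T` and `T'` are never used in the same cycle, so they may overlap; only the
common path in `S` must avoid both. -/
theorem PathIn.win_of_three_le {S T T' : Set V} {x y : V} {p a b : ℕ} (h : G.PathIn S x y p)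
    (h1 : G.PathIn T x y a) (h2 : G.PathIn T' x y b) (hab : b = a + 2) (hpar : (p + a) % 2 = 0)
    (hp : 3 ≤ p + a) (hxy : x ≠ y)
    (hd : ∀ u, u ∈ S → u ∈ T → u = x ∨ u = y) (hd' : ∀ u, u ∈ S → u ∈ T' → u = x ∨ u = y) :
    G.Win := by
  have ha := h1.pos_of_ne hxy
  exact win_of_cyc (h.close h1 hd ha (by omega)) (h.close h2 hd' (by omega) (by omega))
    (by omega) hpar

theorem PathIn.win {S T T' : Set V} {x y : V} {p a b : ℕ} (h : G.PathIn S x y p)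
    (h1 : G.PathIn T x y a) (h2 : G.PathIn T' x y b) (hab : b = a + 2) (hpar : (p + a) % 2 = 0)
    (hp : 2 ≤ p) (hxy : x ≠ y)
    (hd : ∀ u, u ∈ S → u ∈ T → u = x ∨ u = y) (hd' : ∀ u, u ∈ S → u ∈ T' → u = x ∨ u = y) :
    G.Win :=
  h.win_of_three_le h1 h2 hab hpar (by have := h1.pos_of_ne hxy; omega) hxy hd hd'

/-! ### Reachability and connected sets -/

namespace Reach

variable {S T : Set V} {x y z : V}

theorem mono (h : G.Reach S x y) (hST : S ⊆ T) : G.Reach T x y :=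
  ⟨hST h.1, h.2.lift id fun _ _ h => ⟨h.1, hST h.2⟩⟩

theorem refl (hx : x ∈ S) : G.Reach S x x := ⟨hx, Relation.ReflTransGen.refl⟩

theorem right_mem (h : G.Reach S x y) : y ∈ S := by
  obtain ⟨hx, h⟩ := h
  induction h with
  | refl => exact hx
  | tail _ h _ => exact h.2

theorem trans (h : G.Reach S x y) (h' : G.Reach S y z) : G.Reach S x z :=
  ⟨h.1, h.2.trans h'.2⟩

theorem tail (h : G.Reach S x y) (hyz : G.Adj y z) (hz : z ∈ S) : G.Reach S x z :=
  ⟨h.1, h.2.tail ⟨hyz, hz⟩⟩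

theorem single (hx : x ∈ S) (hxy : G.Adj x y) (hy : y ∈ S) : G.Reach S x y :=
  (refl hx).tail hxy hy

theorem symm (h : G.Reach S x y) : G.Reach S y x := by
  obtain ⟨hx, h⟩ := h
  induction h with
  | refl => exact refl hx
  | tail hh h ih =>
    exact (single h.2 h.1.symm (Reach.right_mem ⟨hx, hh⟩)).trans ih

/-- A walk that leaves `A` has a first step out of `A`. -/
theorem exit (h : G.Reach S x y) (A : Set V) (hx : x ∈ A) (hy : y ∉ A) :
    ∃ a b, G.Reach (S ∩ A) x a ∧ G.Adj a b ∧ b ∈ S ∧ b ∉ A := by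
  obtain ⟨hxS, h⟩ := h
  induction h with
  | refl => exact (hy hx).elim
  | @tail b c hh h ih =>
    by_cases hb : b ∈ A
    · by_contra hcon
      have key : ∀ d, Relation.ReflTransGen (fun a b => G.Adj a b ∧ b ∈ S) x d →
          G.Reach (S ∩ A) x d := by
        intro d hd
        induction hd with
        | refl => exact refl ⟨hxS, hx⟩
        | @tail e f he hef ih2 =>
          by_cases hf : f ∈ A
          · exact ih2.tail hef.1 ⟨hef.2, hf⟩
          · exact (hcon ⟨e, f, ih2, hef.1, hef.2, hf⟩).elim
      exact hcon ⟨b, c, key b hh, h.1, h.2, hy⟩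
    · exact ih hb

theorem exists_pathIn (h : G.Reach S x y) : ∃ n, G.PathIn S x y n := by
  obtain ⟨hxS, h⟩ := h
  induction h with
  | refl => exact ⟨0, PathIn.single hxS⟩
  | @tail b c hh h ih =>
    obtain ⟨n, q, h0, hn, ha, hi, hS⟩ := ih
    by_cases hc : ∃ i ≤ n, q i = c
    · obtain ⟨i, hin, hic⟩ := hc
      exact ⟨i, q, h0, hic, fun j hj => ha j (by omega),
        fun j hj k hk => hi j (by omega) k (by omega), fun j hj => hS j (by omega)⟩
    · push Not at hc
      refine ⟨n + 1, ?_⟩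
      have hp : G.PathIn (S \ {c}) x b n :=
        ⟨q, h0, hn, ha, hi, fun i hi => ⟨hS i hi, hc i hi⟩⟩
      refine (hp.snoc h.1 (by simp)).mono ?_
      rintro u (rfl | hu)
      · exact h.2
      · exact hu.1

end Reach

theorem PathIn.reach {S : Set V} {x y : V} {n : ℕ} (h : G.PathIn S x y n) : G.Reach S x y := by
  obtain ⟨q, h0, hn, ha, hi, hS⟩ := h
  subst h0 hn
  have : ∀ i ≤ n, G.Reach S (q 0) (q i) := by
    intro i hin
    induction i with
    | zero => exact Reach.refl (hS 0 hin)
    | succ i ih => exact (ih (by omega)).tail (ha i (by omega)) (hS _ hin)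
  exact this n le_rfl

theorem ConnOn.exists_pathIn {S : Set V} (h : G.ConnOn S) {x y : V} (hx : x ∈ S) (hy : y ∈ S) :
    ∃ n, G.PathIn S x y n := (h x hx y hy).exists_pathIn

theorem ConnOn.union {S T : Set V} (hS : G.ConnOn S) (hT : G.ConnOn T) {a b : V} (ha : a ∈ S)
    (hb : b ∈ T) (hab : a = b ∨ G.Adj a b) : G.ConnOn (S ∪ T) := by
  have hab' : G.Reach (S ∪ T) a b := by
    rcases hab with rfl | hab
    · exact Reach.refl (Or.inl ha)
    · exact Reach.single (Or.inl ha) hab (Or.inr hb)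
  have key : ∀ x ∈ S ∪ T, G.Reach (S ∪ T) x a := by
    rintro x (hx | hx)
    · exact (hS x hx a ha).mono Set.subset_union_left
    · exact ((hT x hx b hb).mono Set.subset_union_right).trans hab'.symm
  exact fun x hx y hy => (key x hx).trans (key y hy).symm

theorem ConnOn.insert_adj {S : Set V} (hS : G.ConnOn S) {a b : V} (ha : a ∈ S) (hab : G.Adj a b) :
    G.ConnOn (insert b S) := by
  have hb : G.ConnOn {b} := by
    rintro x rfl y rfl
    exact Reach.refl rfl
  have := hS.union hb ha rfl (Or.inr hab)
  rwa [Set.union_singleton] at this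

/-- The set of vertices reachable from `x` inside `S`. -/
def comp (G : SimpleGraph V) (S : Set V) (x : V) : Set V := {y | G.Reach S x y}

theorem comp_subset {S : Set V} {x : V} : G.comp S x ⊆ S := fun _ h => h.right_mem

theorem mem_comp_self {S : Set V} {x : V} (hx : x ∈ S) : x ∈ G.comp S x := Reach.refl hx

theorem mem_comp_of_adj {S : Set V} {x y z : V} (hy : y ∈ G.comp S x) (hyz : G.Adj y z)
    (hz : z ∈ S) : z ∈ G.comp S x := Reach.tail hy hyz hz

theorem connOn_comp {S : Set V} {x : V} : G.ConnOn (G.comp S x) := by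
  have key : ∀ y, G.Reach S x y → G.Reach (G.comp S x) x y := by
    rintro y ⟨hx, h⟩
    induction h with
    | refl => exact Reach.refl (Reach.refl hx)
    | tail hh h ih => exact ih.tail h.1 (Reach.tail ⟨hx, hh⟩ h.1 h.2)
  exact fun a ha b hb => (key a ha).symm.trans (key b hb)

/-! ### Cycles as periodic sequences and their arcs -/

namespace IsCyc

variable {n : ℕ} {v : ℤ → V}

theorem shift (h : G.IsCyc n v) (k : ℤ) : G.IsCyc n (fun i => v (i + k)) where
  three_le := h.three_le
  period i := by rw [← h.period (i + k)]; congr 1; ring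
  adj i := by have := h.adj (i + k); rwa [show i + k + 1 = i + 1 + k by ring] at this
  inj i j hij h1 h2 := by have := h.inj _ _ hij (by omega) (by omega); omega

theorem neg (h : G.IsCyc n v) : G.IsCyc n (fun i => v (-i)) where
  three_le := h.three_le
  period i := by rw [← h.period (-(i + n))]; congr 1; ring
  adj i := by
    have := h.adj (-(i + 1)); rw [show -(i + 1) + 1 = -i by ring] at this; exact this.symm
  inj i j hij h1 h2 := by have := h.inj _ _ hij (by omega) (by omega); omega

theorem period_mul (h : G.IsCyc n v) (i k : ℤ) : v (i + k * n) = v i := by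
  induction k using Int.induction_on with
  | zero => simp
  | succ k ih => rw [← ih, ← h.period (i + k * n)]; congr 1; ring
  | pred k ih => rw [← ih, ← h.period (i + (-k - 1) * n)]; congr 1; ring

theorem exists_rep (h : G.IsCyc n v) (a i : ℤ) : ∃ j, a ≤ j ∧ j < a + n ∧ v j = v i := by
  have hn : (0 : ℤ) < n := by have := h.three_le; omega
  refine ⟨a + (i - a) % n, ?_, ?_, ?_⟩
  · have := Int.emod_nonneg (i - a) hn.ne'; omega
  · have := Int.emod_lt_of_pos (i - a) hn; omega
  · rw [← h.period_mul (a + (i - a) % n) ((i - a) / n)]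
    congr 1
    have := Int.emod_add_mul_ediv (i - a) n
    linarith

theorem arc (h : G.IsCyc n v) (i : ℤ) {k : ℕ} (hk : k < n) :
    G.PathIn (v '' Set.Icc i (i + k)) (v i) (v (i + k)) k := by
  refine ⟨fun t => v (i + t), by simp, rfl, fun t _ => ?_, ?_, ?_⟩
  · have := h.adj (i + t); rwa [show i + (t : ℤ) + 1 = i + (t + 1 : ℕ) by push_cast; ring] at this
  · intro a ha b hb hab
    have := h.inj _ _ hab (by omega) (by omega)
    omega
  · intro t ht
    exact ⟨i + t, ⟨by omega, by omega⟩, rfl⟩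

theorem arc' (h : G.IsCyc n v) {i j : ℤ} (hij : i ≤ j) (hj : j < i + n) :
    G.PathIn (v '' Set.Icc i j) (v i) (v j) (j - i).toNat := by
  have := h.arc i (k := (j - i).toNat) (by omega)
  rwa [show i + ((j - i).toNat : ℤ) = j by omega] at this

theorem arc_range (h : G.IsCyc n v) {i j : ℤ} (hij : i ≤ j) (hj : j < i + n) :
    G.PathIn (Set.range v) (v i) (v j) (j - i).toNat :=
  (h.arc' hij hj).mono (Set.image_subset_range _ _)

theorem arc_range' (h : G.IsCyc n v) {i j : ℤ} (hij : i < j) (hj : j ≤ i + n) :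
    G.PathIn (Set.range v) (v i) (v j) (n - (j - i)).toNat := by
  have := (h.arc_range (i := j) (j := i + n) hj (by omega)).symm
  rwa [h.period, show (i + n - j).toNat = (n - (j - i)).toNat by congr 1; ring] at this

theorem cycIn (h : G.IsCyc n v) : G.CycIn (Set.range v) n := by
  have h3 := h.three_le
  refine ⟨h.three_le, v 0, v (0 + (n - 1 : ℕ)), ?_, (h.arc 0 (by omega)).mono (Set.image_subset_range _ _)⟩
  have := h.adj (0 + (n - 1 : ℕ))
  rwa [show (0 : ℤ) + (n - 1 : ℕ) + 1 = 0 + n by omega, h.period] at this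

theorem connOn (h : G.IsCyc n v) : G.ConnOn (Set.range v) := by
  rintro _ ⟨i, rfl⟩ _ ⟨j, rfl⟩
  obtain ⟨k, h1, h2, h3⟩ := h.exists_rep i j
  rw [← h3]
  exact (h.arc_range h1 h2).reach

end IsCyc

theorem IsCyc.of_path {n : ℕ} {q : ℕ → V} (h3 : 3 ≤ n)
    (ha : ∀ i < n - 1, G.Adj (q i) (q (i + 1)))
    (hi : ∀ i ≤ n - 1, ∀ j ≤ n - 1, q i = q j → i = j) (hclose : G.Adj (q (n - 1)) (q 0)) :
    G.IsCyc n fun i => q (i % n).toNat := by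
  have hn0 : (0 : ℤ) < n := by omega
  have hnn : ∀ i : ℤ, 0 ≤ i % n := fun i => Int.emod_nonneg i hn0.ne'
  have hlt : ∀ i : ℤ, i % n < n := fun i => Int.emod_lt_of_pos i hn0
  refine ⟨h3, ?_, ?_, ?_⟩
  · intro i; simp
  · intro i
    have e := Int.emod_emod_of_dvd i (dvd_refl (n : ℤ))
    have e1 : (i + 1) % n = (i % n + 1) % n := by simp [Int.add_emod]
    have a1 := hnn i
    have a2 := hlt i
    by_cases hc : i % n + 1 = n
    · rw [e1, hc, Int.emod_self]
      rw [show (i % n).toNat = n - 1 by omega]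
      simpa using hclose
    · rw [e1, Int.emod_eq_of_lt (a := i % n + 1) (by omega) (by omega)]
      have := ha (i % n).toNat (by omega)
      rwa [show (i % n).toNat + 1 = (i % n + 1).toNat by omega] at this
  · intro i j hij h1 h2
    have a1 := hnn i
    have a2 := hlt i
    have a3 := hnn j
    have a4 := hlt j
    have := hi _ (by omega) _ (by omega) hij
    have e : i % n = j % n := by omega
    obtain ⟨k, hk⟩ := Int.ModEq.dvd (n := n) e
    have : k = 0 := by
      by_contra hk0
      rcases lt_or_gt_of_ne hk0 with h | h
      · nlinarith
      · nlinarith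
    subst this
    simp at hk
    omega

theorem CycIn.exists_isCyc {S : Set V} {n : ℕ} (h : G.CycIn S n) :
    ∃ v, G.IsCyc n v ∧ Set.range v ⊆ S := by
  obtain ⟨h3, x, y, hxy, q, h0, hn, ha, hi, hS⟩ := h
  subst h0 hn
  refine ⟨_, IsCyc.of_path h3 ha hi hxy, ?_⟩
  rintro _ ⟨i, rfl⟩
  have a1 := Int.emod_nonneg i (b := n) (by omega)
  have a2 := Int.emod_lt_of_pos i (b := n) (by omega)
  exact hS _ (by omega)

/-! ### Return to walks, and the usable form of 3-connectivity -/

theorem PathIn.exists_walk {S : Set V} {x y : V} {n : ℕ} (h : G.PathIn S x y n) :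
    ∃ p : G.Walk x y, p.IsPath ∧ p.length = n ∧ ∀ u ∈ p.support, u ∈ S := by
  induction n generalizing S x with
  | zero =>
    obtain rfl := h.eq_of_zero
    exact ⟨Walk.nil, by simp, by simp, by simpa using h.left_mem⟩
  | succ n ih =>
    obtain ⟨z, hz, hp⟩ := h.uncons
    obtain ⟨p, h1, h2, h3⟩ := ih hp
    refine ⟨Walk.cons hz p, ?_, by simp [h2], ?_⟩
    · rw [Walk.cons_isPath_iff]
      exact ⟨h1, fun hx => (h3 _ hx).2 rfl⟩
    · intro u hu
      rw [Walk.support_cons, List.mem_cons] at hu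
      rcases hu with rfl | hu
      · exact h.left_mem
      · exact (h3 _ hu).1

theorem CycIn.exists_walk {S : Set V} {n : ℕ} (h : G.CycIn S n) :
    ∃ (u : V) (c : G.Walk u u), c.IsCycle ∧ c.length = n := by
  obtain ⟨h3, x, y, hyx, hp⟩ := h
  obtain ⟨p, h1, h2, -⟩ := hp.exists_walk
  refine ⟨y, Walk.cons hyx p, ?_, by simp [h2]; omega⟩
  rw [Walk.cons_isCycle_iff]
  refine ⟨h1, fun hmem => ?_⟩
  have := h1.length_eq_one_of_mem_edges (u := x) (v := y) (by rwa [Sym2.eq_swap] at hmem)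
  omega

theorem Win.hasConsecutiveEvenCycles (h : G.Win) : G.HasConsecutiveEvenCycles := by
  obtain ⟨m, h1, h2⟩ := h
  obtain ⟨u, c, hc, hl⟩ := h1.exists_walk
  obtain ⟨u', c', hc', hl'⟩ := h2.exists_walk
  exact ⟨m, u, u', c, c', hc, hc', hl, hl'⟩

/-- At least six vertices, and the removal of any two vertices leaves a connected graph. -/
structure TriConn (G : SimpleGraph V) : Prop where
  many : ∀ s : Finset V, s.card ≤ 5 → ∃ u, u ∉ s
  reach : ∀ a b x y : V, x ≠ a → x ≠ b → y ≠ a → y ≠ b → G.Reach {u | u ≠ a ∧ u ≠ b} x y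

theorem IsKConnected.triConn [Fintype V] (h : G.IsKConnected 3) (hV : 6 ≤ Fintype.card V) :
    G.TriConn where
  many s hs := by
    by_contra! hcon
    have : Finset.univ ⊆ s := fun u _ => hcon u
    have := Finset.card_le_card this
    rw [Finset.card_univ] at this
    omega
  reach a b x y hxa hxb hya hyb := by
    classical
    have hc := (h.2 {a, b} (by have := Finset.card_le_two (a := a) (b := b); omega)).preconnected
      ⟨x, by simp [hxa, hxb]⟩ ⟨y, by simp [hya, hyb]⟩
    rw [reachable_iff_reflTransGen] at hc
    refine ⟨⟨hxa, hxb⟩, hc.lift (fun u => u.1) ?_⟩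
    rintro ⟨u, hu⟩ ⟨w, hw⟩ huw
    refine ⟨huw, ?_⟩
    simpa using hw

namespace TriConn

variable (hG : G.TriConn)
include hG

/-- Minimum degree three. If `a` or `b` equals `v`, excluding it costs nothing, since no vertex is
its own neighbour. -/
theorem exists_adj (v a b : V) : ∃ u, G.Adj v u ∧ u ≠ a ∧ u ≠ b := by
  classical
  have main : ∀ a b, v ≠ a → v ≠ b → ∃ u, G.Adj v u ∧ u ≠ a ∧ u ≠ b := by
    intro a b ha hb
    obtain ⟨y, hy⟩ := hG.many {v, a, b} (by have := Finset.card_le_three (a := v) (b := a) (c := b); omega)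
    simp only [Finset.mem_insert, Finset.mem_singleton, not_or] at hy
    obtain ⟨c, d, h1, h2, h3, h4⟩ := (hG.reach a b v y ha hb hy.2.1 hy.2.2).exit {v} rfl hy.1
    obtain rfl : c = v := h1.right_mem.2
    exact ⟨d, h2, h3.1, h3.2⟩
  by_cases ha : v = a
  · by_cases hb : v = b
    · subst ha hb
      obtain ⟨y, hy⟩ := hG.many {v} (by simp)
      simp only [Finset.mem_singleton] at hy
      obtain ⟨u, hu, -, -⟩ := main y y (Ne.symm hy) (Ne.symm hy)
      exact ⟨u, hu, hu.ne', hu.ne'⟩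
    · obtain ⟨u, hu, h1, -⟩ := main b b hb hb
      exact ⟨u, hu, ha ▸ hu.ne', h1⟩
  · by_cases hb : v = b
    · obtain ⟨u, hu, h1, -⟩ := main a a ha ha
      exact ⟨u, hu, h1, hb ▸ hu.ne'⟩
    · exact main a b ha hb

theorem exists_cross (K : Set V) {a b x y : V} (hx : x ∈ K) (hy : y ∉ K) (hxa : x ≠ a)
    (hxb : x ≠ b) (hya : y ≠ a) (hyb : y ≠ b) :
    ∃ k ∈ K, ∃ u, u ∉ K ∧ G.Adj k u ∧ u ≠ a ∧ u ≠ b ∧ k ≠ a ∧ k ≠ b := by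
  obtain ⟨c, d, h1, h2, h3, h4⟩ := (hG.reach a b x y hxa hxb hya hyb).exit K hx hy
  exact ⟨c, h1.right_mem.2, d, h4, h2, h3.1, h3.2, h1.right_mem.1.1, h1.right_mem.1.2⟩

end TriConn

/-! ### Tripods and parity -/

/-- Among three vertices attached to a connected set, two are joined through the set by a path of
prescribed parity, for any prescription that comes from labels. -/
theorem ConnOn.tripod {W : Set V} (hW : G.ConnOn W) (p x : Fin 3 → V) (c : Fin 3 → ℤ)
    (hp : Function.Injective p) (hpW : ∀ i, p i ∉ W) (hx : ∀ i, x i ∈ W)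
    (hpx : ∀ i, G.Adj (p i) (x i)) :
    ∃ i j n, i < j ∧ 2 ≤ n ∧ G.PathIn (insert (p i) (insert (p j) W)) (p i) (p j) n ∧
      ((n : ℤ) - (c i + c j)) % 2 = 0 := by
  obtain ⟨m, q, h0, hm, ha, hi, hS⟩ := hW.exists_pathIn (hx 0) (hx 1)
  -- The third leg runs from `x 2` to its first vertex `q t` on the path from `x 0` to `x 1`.
  have hleg : ∃ t ≤ m, ∃ l, ∃ S : Set V, S ⊆ W ∧ G.PathIn S (x 2) (q t) l ∧
      ∀ u ∈ S, ∀ j ≤ m, q j = u → u = q t := by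
    by_cases hx2 : ∃ t ≤ m, q t = x 2
    · obtain ⟨t, ht, h⟩ := hx2
      refine ⟨t, ht, 0, {q t}, by simpa using hS t ht, ?_, ?_⟩
      · rw [h]; exact PathIn.single rfl
      · rintro u rfl _ _ _; rfl
    · have hr := hW (x 2) (hx 2) (q 0) (hS 0 (Nat.zero_le _))
      obtain ⟨a, b, h1, h2, h3, h4⟩ := hr.exit {u | ∀ t ≤ m, q t ≠ u}
        (by push Not at hx2; exact hx2) (by simpa using ⟨0, Nat.zero_le _, rfl⟩)
      simp only [Set.mem_ofPred_eq, not_forall, not_not] at h4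
      obtain ⟨t, ht, rfl⟩ := h4
      obtain ⟨l, hl⟩ := h1.exists_pathIn
      refine ⟨t, ht, l + 1, _, ?_, hl.snoc h2 (fun h => h.2 t ht rfl), ?_⟩
      · rintro u (rfl | hu)
        · exact hS t ht
        · exact hu.1
      · rintro u (rfl | hu) j hj hju
        · rfl
        · exact (hu.2 j hj hju).elim
  obtain ⟨t, ht, l, S, hSW, hl, hSq⟩ := hleg
  have p01 : G.PathIn W (x 0) (x 1) m := ⟨q, h0, hm, ha, hi, hS⟩
  have p0t : G.PathIn (q '' Set.Iic t) (x 0) (q t) t :=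
    ⟨q, h0, rfl, fun i h => ha i (by omega), fun i h j h' => hi i (by omega) j (by omega),
      fun i h => ⟨i, h, rfl⟩⟩
  have pt1 : G.PathIn (q '' Set.Icc t m) (q t) (x 1) (m - t) := by
    refine ⟨fun i => q (t + i), rfl, ?_, fun i h => ha (t + i) (by omega), fun i h j h' hij => ?_,
      fun i h => ⟨t + i, ⟨by omega, by omega⟩, rfl⟩⟩
    · simp only [show t + (m - t) = m by omega, hm]
    · have := hi _ (by omega) _ (by omega) hij
      omega
  have p02 : G.PathIn W (x 0) (x 2) (t + l) := by
    refine (p0t.append hl.symm ?_).mono ?_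
    · rintro u ⟨j, hj, rfl⟩ hu
      exact hSq _ hu j (le_trans hj ht) rfl
    · refine Set.union_subset ?_ hSW
      rintro _ ⟨j, hj, rfl⟩
      exact hS j (le_trans hj ht)
  have p12 : G.PathIn W (x 1) (x 2) (m - t + l) := by
    refine (pt1.symm.append hl.symm ?_).mono ?_
    · rintro u ⟨j, hj, rfl⟩ hu
      exact hSq _ hu j hj.2 rfl
    · refine Set.union_subset ?_ hSW
      rintro _ ⟨j, hj, rfl⟩
      exact hS j hj.2
  have e01 := p01.ends (hpx 0) (hpx 1) (hp.ne (by decide)) (hpW 0) (hpW 1)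
  have e02 := p02.ends (hpx 0) (hpx 2) (hp.ne (by decide)) (hpW 0) (hpW 2)
  have e12 := p12.ends (hpx 1) (hpx 2) (hp.ne (by decide)) (hpW 1) (hpW 2)
  -- Every leg, like every label, is counted in exactly two of the three pairs, so the three
  -- differences have even sum. An even number of them is odd, and at least one pair has the
  -- required parity.
  by_cases c01 : (((m + 2 : ℕ) : ℤ) - (c 0 + c 1)) % 2 = 0
  · exact ⟨0, 1, _, by decide, by omega, e01, c01⟩
  by_cases c02 : (((t + l + 2 : ℕ) : ℤ) - (c 0 + c 2)) % 2 = 0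
  · exact ⟨0, 2, _, by decide, by omega, e02, c02⟩
  exact ⟨1, 2, _, by decide, by omega, e12, by omega⟩

theorem ConnOn.tripod₃ {W : Set V} (hW : G.ConnOn W) {p q r x y z : V} (a b c : ℤ)
    (hpq : p ≠ q) (hpr : p ≠ r) (hqr : q ≠ r) (hp : p ∉ W) (hq : q ∉ W) (hr : r ∉ W)
    (hx : x ∈ W) (hy : y ∈ W) (hz : z ∈ W) (hpx : G.Adj p x) (hqy : G.Adj q y)
    (hrz : G.Adj r z) : ∃ n, 2 ≤ n ∧
      (G.PathIn (insert p (insert q W)) p q n ∧ ((n : ℤ) - (a + b)) % 2 = 0 ∨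
       G.PathIn (insert p (insert r W)) p r n ∧ ((n : ℤ) - (a + c)) % 2 = 0 ∨
       G.PathIn (insert q (insert r W)) q r n ∧ ((n : ℤ) - (b + c)) % 2 = 0) := by
  obtain ⟨i, j, n, hij, hn, h1, h2⟩ := hW.tripod ![p, q, r] ![x, y, z] ![a, b, c]
    (by
      intro i j hij
      fin_cases i <;> fin_cases j
      · rfl
      · exact (hpq hij).elim
      · exact (hpr hij).elim
      · exact (hpq hij.symm).elim
      · rfl
      · exact (hqr hij).elim
      · exact (hpr hij.symm).elim
      · exact (hqr hij.symm).elim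
      · rfl)
    (by intro i; fin_cases i; exacts [hp, hq, hr])
    (by intro i; fin_cases i; exacts [hx, hy, hz])
    (by intro i; fin_cases i; exacts [hpx, hqy, hrz])
  refine ⟨n, hn, ?_⟩
  fin_cases i <;> fin_cases j
  · exact (lt_irrefl _ hij).elim
  · exact Or.inl ⟨h1, h2⟩
  · exact Or.inr (Or.inl ⟨h1, h2⟩)
  · exact (absurd hij (by decide))
  · exact (lt_irrefl _ hij).elim
  · exact Or.inr (Or.inr ⟨h1, h2⟩)
  · exact (absurd hij (by decide))
  · exact (absurd hij (by decide))
  · exact (lt_irrefl _ hij).elim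

theorem IsCyc.arc_inter {n : ℕ} {v : ℤ → V} (h : G.IsCyc n v) {i j : ℤ} (hij : i < j)
    (hj : j < i + n) {c : V} (h1 : c ∈ v '' Set.Icc i j) (h2 : c ∈ v '' Set.Icc j (i + n)) :
    c = v i ∨ c = v j := by
  obtain ⟨a, ⟨ha1, ha2⟩, rfl⟩ := h1
  obtain ⟨b, ⟨hb1, hb2⟩, hab⟩ := h2
  by_cases hc : b = i + n ∧ a = i
  · exact Or.inl (by rw [hc.2])
  · have := h.inj _ _ hab (by omega) (by omega)
    exact Or.inr (by rw [show a = j by omega])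

/-! ### Combinatorics of chords on integer positions -/

theorem attached_of_four {n : ℤ} {T : ℤ → Prop}
    (T3 : ∀ a b, ∃ t, 0 ≤ t ∧ t < n ∧ T t ∧ t ≠ a ∧ t ≠ b) {a b c d : ℤ}
    (h4 : ∀ t, T t → 0 ≤ t → t < n → t = a ∨ t = b ∨ t = c ∨ t = d) (hd : ¬ T d) :
    T a ∧ T b ∧ T c := by
  have key : ∀ x y z, (∀ t, T t → 0 ≤ t → t < n → t = x ∨ t = y ∨ t = z ∨ t = d) → T x := by
    intro x y z h
    obtain ⟨t, h1, h2, h3, h5, h6⟩ := T3 y z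
    rcases h t h3 h1 h2 with rfl | rfl | rfl | rfl
    · exact h3
    · exact (h5 rfl).elim
    · exact (h6 rfl).elim
    · exact (hd h3).elim
  refine ⟨key a b c h4, key b a c fun t h1 h2 h3 => ?_, key c a b fun t h1 h2 h3 => ?_⟩
  · have := h4 t h1 h2 h3; tauto
  · have := h4 t h1 h2 h3; tauto

set_option maxHeartbeats 1000000 in
/-- The combinatorics of the chords of an even cycle that is minimal in the sense of the maximality
of the complementary connected set: `T` are the attached positions, `C` the chords. -/
theorem chords_unique (s : ℤ) (hs : 3 ≤ s) (T : ℤ → Prop) (C : ℤ → ℤ → Prop)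
    (hTp : ∀ i, T (i + 2 * s) ↔ T i)
    (hC : ∀ i j, C i j → i + 2 ≤ j ∧ j + 2 ≤ i + 2 * s ∧ (j - i) % 2 = 0)
    (hrot : ∀ i j, C i j → C j (i + 2 * s))
    (hper : ∀ i j, C (i + 2 * s) (j + 2 * s) → C i j)
    (hT : ∀ i, ¬ T i → ∃ j, C i j)
    (NC : ∀ a b c d, C a b → C c d → b ≤ c → d ≤ a + 2 * s → ¬ (b = c ∧ d = a + 2 * s) →
      ∀ t, T t → ¬ (a < t ∧ t < b) ∧ ¬ (c < t ∧ t < d))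
    (CR : ∀ a b c d, C a b → C c d → a < c → c < b → b < d → d < a + 2 * s →
      ∀ t, T t → a ≤ t → t < a + 2 * s → t = a ∨ t = b ∨ t = c ∨ t = d)
    (T3 : ∀ a b, ∃ t, 0 ≤ t ∧ t < 2 * s ∧ T t ∧ t ≠ a ∧ t ≠ b)
    (k : ℤ) (h0k : C 0 k) (hmin : ∀ i j, C i j → k ≤ j - i) (r : ℤ) (hr0 : 0 < r)
    (hr1 : r < 2 * s) (hrk : r ≠ k) : T r := by
  have hk := hC _ _ h0k
  have hinner : ∀ r, 0 < r → r < k → ¬ T r → ∃ j, C r j ∧ k < j ∧ j < 2 * s := by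
    intro r h1 h2 h3
    obtain ⟨j, hj⟩ := hT r h3
    have a1 := hC _ _ hj
    have a2 := hmin _ _ hj
    have a3 := hmin _ _ (hrot _ _ hj)
    exact ⟨j, hj, by omega, by omega⟩
  have hone : ¬ T 1 → ∃ i j, C i j ∧ 0 < i ∧ i < k ∧ k < j ∧ j < 2 * s := by
    intro h
    obtain ⟨j, h1, h2, h3⟩ := hinner 1 (by omega) (by omega) h
    exact ⟨1, j, h1, by omega, by omega, h2, h3⟩
  -- a chord from a vertex on the far side
  have houter : ∀ r, k < r → r < 2 * s → ¬ T r →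
      (∃ i, C i r ∧ 0 < i ∧ i < k) ∨ (∃ lo hi, C lo hi ∧ k ≤ lo ∧ hi ≤ 2 * s ∧ (r = lo ∨ r = hi)) := by
    intro r h1 h2 h3
    obtain ⟨j, hj⟩ := hT r h3
    have a1 := hC _ _ hj
    by_cases hj2 : j ≤ 2 * s
    · exact Or.inr ⟨r, j, hj, by omega, hj2, Or.inl rfl⟩
    · have a4 : C (j - 2 * s) r := by
        apply hper
        have := hrot _ _ hj
        rwa [show j - 2 * s + 2 * s = j by ring]
      by_cases hjk : j - 2 * s < k
      · exact Or.inl ⟨_, a4, by omega, hjk⟩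
      · exact Or.inr ⟨_, _, a4, by omega, by omega, Or.inr rfl⟩
  by_contra hTr
  -- An unattached position yields a chord crossing `(0, k)`. Under the cap this is minimality of
  -- `k`. A far chord that does not cross would, by `NC`, leave position 1 unattached, and the chord
  -- at 1 crosses.
  have hcross : ∃ i j, C i j ∧ 0 < i ∧ i < k ∧ k < j ∧ j < 2 * s := by
    by_cases hrk' : r < k
    · obtain ⟨j, h1, h2, h3⟩ := hinner r hr0 hrk' hTr
      exact ⟨r, j, h1, hr0, hrk', h2, h3⟩
    · rcases houter r (by omega) hr1 hTr with ⟨i, h1, h2, h3⟩ | ⟨lo, hi, h1, h2, h3, h4⟩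
      · exact ⟨i, r, h1, h2, h3, by omega, hr1⟩
      · refine hone fun hT1 => ?_
        have := NC 0 k lo hi h0k h1 h2 (by omega) (by omega) 1 hT1
        omega
  clear hTr hr0 hr1 hrk r
  obtain ⟨i, j, hij, hi0, hik, hkj, hjs⟩ := hcross
  have hT4 := CR 0 k i j h0k hij hi0 hik hkj (by omega)
  -- All attached positions are now among `0, k, i, j`. Since `2 * s ≥ 6`, one of `1, 2, 3, 4` is a
  -- further position; it is unattached and carries another chord, which is refuted case by case.
  obtain ⟨r, hr0, hrs, hri, hrk, hrj⟩ : ∃ r, 0 < r ∧ r < 2 * s ∧ r ≠ i ∧ r ≠ k ∧ r ≠ j := by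
    by_contra! hcon
    have h1 := hcon 1 (by omega) (by omega)
    have h2 := hcon 2 (by omega) (by omega)
    have h3 := hcon 3 (by omega) (by omega)
    have h4 := hcon 4 (by omega) (by omega)
    omega
  have hTr : ¬ T r := fun h => by
    have := hT4 r h hr0.le (by omega)
    omega
  have hT2s : T (2 * s) ↔ T 0 := by simpa using hTp 0
  have hi3 : ¬ T i → T 0 ∧ T k ∧ T j := fun h =>
    attached_of_four T3 (fun t h1 h2 h3 => by have := hT4 t h1 h2 (by omega); tauto) h
  have hj3 : ¬ T j → T 0 ∧ T k ∧ T i := fun h =>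
    attached_of_four T3 (fun t h1 h2 h3 => by have := hT4 t h1 h2 (by omega); tauto) h
  by_cases hrk' : r < k
  · obtain ⟨r', g1, g2, g3⟩ := hinner r hr0 hrk' hTr
    have hT4' := CR 0 k r r' h0k g1 hr0 hrk' g2 (by omega)
    have hTi : ¬ T i := fun h => by
      have := hT4' i h (by omega) (by omega)
      omega
    obtain ⟨b0, bk, bj⟩ := hi3 hTi
    have := hT4' j bj (by omega) (by omega)
    -- Both crossing pairs must account for the three attached positions, so the two chords share
    -- the end `j`; `NC` then bypasses the attached position `k`.
    obtain rfl : j = r' := by omega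
    have c1 := hC _ _ g1
    have c2 := hC _ _ hij
    rcases lt_or_gt_of_ne hri with hlt | hlt
    · have := NC i j j (r + 2 * s) hij (hrot _ _ g1) le_rfl (by omega) (by omega) k bk
      omega
    · have := NC r j j (i + 2 * s) g1 (hrot _ _ hij) le_rfl (by omega) (by omega) k bk
      omega
  · rcases houter r (by omega) hrs hTr with ⟨r', g1, g2, g3⟩ | ⟨lo, hi, g1, g2, g3, g4⟩
    · have hT4' := CR 0 k r' r h0k g1 g2 g3 (by omega) (by omega)
      have hTj : ¬ T j := fun h => by
        have := hT4' j h (by omega) (by omega)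
        omega
      obtain ⟨b0, bk, bi⟩ := hj3 hTj
      have := hT4' i bi (by omega) (by omega)
      obtain rfl : i = r' := by omega
      have c1 := hC _ _ g1
      have c2 := hC _ _ hij
      rcases lt_or_gt_of_ne hrj with hlt | hlt
      · have := NC i r j (i + 2 * s) g1 (hrot _ _ hij) (by omega) (by omega) (by omega) k bk
        omega
      · have := NC i j r (i + 2 * s) hij (hrot _ _ g1) (by omega) (by omega) (by omega) k bk
        omega
    · have c1 := hC _ _ g1
      have c2 := hC _ _ hij
      -- The chord on the far side does not cross `(0, k)`, so nothing strictly under the cap is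
      -- attached and `0, k, j` all are. However it lies relative to `(i, j)`, one of `0`, `k` is
      -- then bypassed.
      have hTi : ¬ T i := fun h => by
        have := (NC 0 k lo hi h0k g1 g2 (by omega) (by omega) i h).1
        omega
      obtain ⟨b0, bk, bj⟩ := hi3 hTi
      rcases le_or_gt j lo with hjl | hjl
      · have := NC i j lo hi hij g1 hjl (by omega) (by omega) k bk
        omega
      rcases le_or_gt hi j with hhj | hhj
      · have := NC lo hi j (i + 2 * s) g1 (hrot _ _ hij) hhj (by omega) (by omega) (2 * s) (hT2s.2 b0)
        omega
      · have h5 := CR i j lo hi hij g1 (by omega) (by omega) (by omega) (by omega)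
        have h6 := h5 k bk (by omega) (by omega)
        have h7 := h5 (2 * s) (hT2s.2 b0) (by omega) (by omega)
        omega

/-! ### Maximal connected sets whose complement contains an even cycle -/

/-- The vertex `c` has a neighbour in `K`. -/
def Att (G : SimpleGraph V) (K : Set V) (c : V) : Prop := ∃ k ∈ K, G.Adj k c

/-- A nonempty connected set `K` such that every even cycle avoiding `K` passes through all the
vertices outside `K` that are attached to `K`. -/
structure MaxEven (G : SimpleGraph V) (K : Set V) : Prop where
  conn : G.ConnOn K
  nonempty : K.Nonempty
  mem : ∀ (S : Set V) (n : ℕ) (c : V), n % 2 = 0 → G.CycIn S n → (∀ u ∈ S, u ∉ K) → c ∉ K →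
    G.Att K c → c ∈ S

theorem exists_maxEven [Finite V] {K₀ : Set V} (hK : G.ConnOn K₀) (hne : K₀.Nonempty) {n : ℕ}
    (hn : n % 2 = 0) (hc : G.CycIn K₀ᶜ n) :
    ∃ K, K₀ ⊆ K ∧ G.MaxEven K ∧ ∃ m, m % 2 = 0 ∧ G.CycIn Kᶜ m := by
  obtain ⟨K, hle, hK⟩ := (Set.toFinite {K : Set V | G.ConnOn K ∧ ∃ m, m % 2 = 0 ∧ G.CycIn Kᶜ m}).exists_le_maximal
    (a := K₀) ⟨hK, n, hn, hc⟩
  refine ⟨K, hle, ⟨hK.prop.1, hne.mono hle, ?_⟩, hK.prop.2⟩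
  rintro S m c hm hS hSK hcK ⟨k, hk, hkc⟩
  by_contra hcS
  -- An attached vertex off the even cycle could be absorbed into `K`, against maximality.
  have := hK.le_of_ge (y := insert c K) ⟨hK.prop.1.insert_adj hk hkc, m, hm, hS.mono ?_⟩
    (Set.subset_insert _ _)
  · exact hcK (this (Set.mem_insert _ _))
  · rintro u hu (rfl | h)
    · exact hcS hu
    · exact hSK u hu h

namespace MaxEven

variable {K : Set V} (hK : G.MaxEven K) {s : ℕ} {v : ℤ → V}
include hK

/-- Two even cycles meet in at least three attached vertices. -/
theorem false_of_inter (hG : G.TriConn) {S T : Set V} {m n : ℕ} {x y z : V}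
    (hm : m % 2 = 0) (hn : n % 2 = 0) (hS : G.CycIn S m) (hT : G.CycIn T n)
    (hSK : ∀ u ∈ S, u ∉ K) (hTK : ∀ u ∈ T, u ∉ K) (hx : x ∉ K) (hy : y ∉ K)
    (hz : z ∉ K) (hzx : z ≠ x) (hzy : z ≠ y)
    (hd : ∀ u, G.Att K u → u ∈ S → u ∈ T → u = x ∨ u = y) : False := by
  obtain ⟨k₀, hk₀⟩ := hK.nonempty
  -- Attached vertices lie on both cycles, hence are `x` or `y`; but these two do not separate `K`
  -- from `z`.
  obtain ⟨k, hk, u, hu, hku, hux, huy, -, -⟩ := hG.exists_cross K (a := x) (b := y) hk₀ hz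
    (fun h => hx (h ▸ hk₀)) (fun h => hy (h ▸ hk₀)) hzx hzy
  have hatt : G.Att K u := ⟨k, hk, hku⟩
  rcases hd u hatt (hK.mem S m u hm hS hSK hu hatt) (hK.mem T n u hn hT hTK hu hatt) with h | h
  · exact hux h
  · exact huy h

/-- The parity condition makes the ear close to an even cycle with either arc. These two cycles meet
only in the ear, whose attached vertices lie on `v` and so are its ends: `false_of_inter` applies.
-/
theorem false_of_ear (hG : G.TriConn) (hv : G.IsCyc (2 * s) v) (hvK : ∀ i, v i ∉ K) {i j : ℤ}
    (hij : i < j) (hj : j < i + 2 * s) {S : Set V} {m : ℕ} (hp : G.PathIn S (v i) (v j) m)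
    (hm3 : 3 ≤ m + (j - i).toNat) (hm3' : 3 ≤ m + (i + 2 * s - j).toNat)
    (hpar : ((m : ℤ) - (i + j)) % 2 = 0) (hSK : ∀ u ∈ S, u ∉ K)
    (hSv : ∀ u ∈ S, u ∈ Set.range v → u = v i ∨ u = v j) : False := by
  have a1 := hv.arc' hij.le (by omega)
  have a2 := hv.arc' (i := j) (j := i + (2 * s : ℕ)) (by push_cast; omega) (by omega)
  have a2 := a2.symm
  rw [hv.period] at a2
  have c1 := hp.close a1 (fun u h1 h2 => hSv u h1 (Set.image_subset_range _ _ h2)) (by omega) hm3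
  have c2 := hp.close a2 (fun u h1 h2 => hSv u h1 (Set.image_subset_range _ _ h2))
    (by omega) (by push_cast; exact hm3')
  have hKv : ∀ I : Set ℤ, ∀ u ∈ S ∪ v '' I, u ∉ K := by
    rintro I u (h | ⟨t, -, rfl⟩)
    · exact hSK u h
    · exact hvK t
  have h3 := hv.three_le
  obtain ⟨t, ht⟩ : ∃ t, v t ≠ v i ∧ v t ≠ v j := by
    by_cases h : j = i + 1
    · exact ⟨i + 2, fun h' => by have := hv.inj _ _ h' (by omega) (by omega); omega,
        fun h' => by have := hv.inj _ _ h' (by omega) (by omega); omega⟩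
    · exact ⟨i + 1, fun h' => by have := hv.inj _ _ h' (by omega) (by omega); omega,
        fun h' => by have := hv.inj _ _ h' (by omega) (by omega); omega⟩
  refine hK.false_of_inter hG (x := v i) (y := v j) (z := v t) (by omega) (by omega)
    c1 c2 (hKv _) (hKv _) (hvK i) (hvK j) (hvK t) ht.1 ht.2 ?_
  rintro u hatt (h1 | h1) h2
  · by_cases hur : u ∈ Set.range v
    · exact hSv u h1 hur
    · obtain ⟨t, rfl⟩ : u ∈ Set.range v := by
        refine hK.mem _ _ u (by omega) hv.cycIn ?_ (hSK u h1) hatt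
        rintro _ ⟨t, rfl⟩; exact hvK t
      exact (hur ⟨t, rfl⟩).elim
  · rcases h2 with h2 | h2
    · exact hSv u h2 (Set.image_subset_range _ _ h1)
    · exact hv.arc_inter hij (by omega) h1 h2

/-- A component of the remaining vertices has no edge to `K`, as attached vertices lie on `v`. So it
attaches to three vertices of `v`, and a tripod labelled by their positions contains an ear of the
parity excluded by `false_of_ear`. -/
theorem cover (hG : G.TriConn) (hv : G.IsCyc (2 * s) v) (hvK : ∀ i, v i ∉ K) (w : V) :
    w ∈ K ∨ w ∈ Set.range v := by
  by_contra! hw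
  set U : Set V := {u | u ∉ K ∧ u ∉ Set.range v} with hU
  set W := G.comp U w with hWdef
  have hwW : w ∈ W := mem_comp_self hw
  have hWU : ∀ u ∈ W, u ∉ K ∧ u ∉ Set.range v := fun u hu => by have := comp_subset (G := G) (S := U) hu; exact this
  have hnb : ∀ x ∈ W, ∀ y, y ∉ W → G.Adj x y → y ∈ Set.range v := by
    intro x hx y hy hxy
    by_contra hyr
    by_cases hyK : y ∈ K
    · refine (hWU x hx).2 (hK.mem _ _ x (by omega) hv.cycIn ?_ (hWU x hx).1 ⟨y, hyK, hxy.symm⟩)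
      rintro _ ⟨t, rfl⟩; exact hvK t
    · exact hy (mem_comp_of_adj hx hxy ⟨hyK, hyr⟩)
  obtain ⟨k₀, hk₀⟩ := hK.nonempty
  have hatt : ∀ a b : ℤ, ∃ i : ℤ, 0 ≤ i ∧ i < 2 * s ∧ v i ≠ v a ∧ v i ≠ v b ∧
      ∃ x ∈ W, G.Adj (v i) x := by
    intro a b
    obtain ⟨x, hx, y, hy, hxy, h1, h2, -, -⟩ := hG.exists_cross W (a := v a) (b := v b) (y := k₀)
      hwW (fun h => (hWU _ h).1 hk₀) (fun h => hw.2 ⟨a, h.symm⟩) (fun h => hw.2 ⟨b, h.symm⟩)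
      (fun h => hvK a (h ▸ hk₀)) (fun h => hvK b (h ▸ hk₀))
    obtain ⟨i', hi'⟩ := hnb x hx y hy hxy
    obtain ⟨i, g1, g2, g3⟩ := hv.exists_rep 0 i'
    rw [hi'] at g3
    exact ⟨i, g1, by omega, g3 ▸ h1, g3 ▸ h2, x, hx, g3 ▸ hxy.symm⟩
  obtain ⟨i₀, a1, a2, -, -, x₀, b1, b2⟩ := hatt 0 0
  obtain ⟨i₁, c1, c2, c3, -, x₁, d1, d2⟩ := hatt i₀ i₀
  obtain ⟨i₂, e1, e2, e3, e4, x₂, f1, f2⟩ := hatt i₀ i₁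
  have n1 : i₁ ≠ i₀ := fun h => c3 (h ▸ rfl)
  have n2 : i₂ ≠ i₀ := fun h => e3 (h ▸ rfl)
  have n3 : i₂ ≠ i₁ := fun h => e4 (h ▸ rfl)
  have main : ∀ i j : ℤ, ∀ n : ℕ, 2 ≤ n → 0 ≤ i → i < 2 * s → 0 ≤ j → j < 2 * s → i ≠ j →
      G.PathIn (insert (v i) (insert (v j) W)) (v i) (v j) n → ((n : ℤ) - (i + j)) % 2 = 0 →
      False := by
    intro i j n hn hi0 hi1 hj0 hj1 hij hp hpar
    have hSK : ∀ u ∈ insert (v i) (insert (v j) W), u ∉ K := by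
      rintro u (rfl | rfl | h)
      · exact hvK i
      · exact hvK j
      · exact (hWU u h).1
    have hSv : ∀ u ∈ insert (v i) (insert (v j) W), u ∈ Set.range v → u = v i ∨ u = v j := by
      rintro u (rfl | rfl | h) hu
      · exact Or.inl rfl
      · exact Or.inr rfl
      · exact ((hWU u h).2 hu).elim
    rcases lt_or_gt_of_ne hij with h | h
    · exact hK.false_of_ear hG hv hvK h (by omega) hp (by omega) (by omega) hpar hSK hSv
    · refine hK.false_of_ear hG hv hvK h (by omega) hp.symm (by omega) (by omega) (by omega) hSK ?_
      intro u h1 h2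
      exact (hSv u h1 h2).symm
  obtain ⟨n, hn, h | h | h⟩ := connOn_comp.tripod₃ (G := G) (W := W) i₀ i₁ i₂ c3.symm e3.symm
    e4.symm (fun h => (hWU _ h).2 ⟨_, rfl⟩) (fun h => (hWU _ h).2 ⟨_, rfl⟩)
    (fun h => (hWU _ h).2 ⟨_, rfl⟩) b1 d1 f1 b2 d2 f2
  · exact main i₀ i₁ n hn a1 a2 c1 c2 n1.symm h.1 h.2
  · exact main i₀ i₂ n hn a1 a2 e1 e2 n2.symm h.1 h.2
  · exact main i₁ i₂ n hn c1 c2 e1 e2 n3.symm h.1 h.2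

/-- A chord of odd span is an ear of length one excluded by `false_of_ear`. -/
theorem chord_even (hG : G.TriConn) (hv : G.IsCyc (2 * s) v) (hvK : ∀ i, v i ∉ K) {i j : ℤ}
    (hij : i + 2 ≤ j) (hj : j + 2 ≤ i + 2 * s) (hadj : G.Adj (v i) (v j)) : (j - i) % 2 = 0 := by
  by_contra hpar
  have hp : G.PathIn {v i, v j} (v i) (v j) (0 + 1) := by
    have := PathIn.cons hadj (PathIn.single (Set.mem_singleton (v j)))
      (by simpa using hadj.ne)
    exact this
  refine hK.false_of_ear hG hv hvK (by omega) (by omega) hp (by omega) (by omega) (by push_cast; omega) ?_ ?_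
  · rintro u (rfl | rfl)
    · exact hvK i
    · exact hvK j
  · rintro u (rfl | rfl) _
    · exact Or.inl rfl
    · exact Or.inr rfl

/-- Shortcutting both arcs by their chords leaves an even cycle, which must contain every attached
vertex. `hne` excludes using one chord twice. -/
theorem chord_nc (hv : G.IsCyc (2 * s) v) (hvK : ∀ i, v i ∉ K) {a b c d : ℤ}
    (hab : G.Adj (v a) (v b)) (hcd : G.Adj (v c) (v d)) (h1 : a < b) (h2 : b ≤ c) (h3 : c < d)
    (h4 : d ≤ a + 2 * s) (hne : ¬ (b = c ∧ d = a + 2 * s)) (hev : (b - a) % 2 = 0)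
    (hev' : (d - c) % 2 = 0) (t : ℤ) (ht : G.Att K (v t)) :
    ¬ (a < t ∧ t < b) ∧ ¬ (c < t ∧ t < d) := by
  have p1 := hv.arc' h2 (by omega)
  have p2 := hv.arc' (i := d) (j := a + (2 * s : ℕ)) (by push_cast; omega) (by omega)
  have p := p1.join hcd p2 (by
    rintro _ ⟨i, ⟨hi1, hi2⟩, rfl⟩ ⟨j, ⟨hj1, hj2⟩, hij⟩
    have := hv.inj _ _ hij (by omega) (by omega)
    omega)
  rw [hv.period] at p
  have hc := p.closeAdj hab.symm (by omega)
  have hm := hK.mem _ _ (v t) (by omega) hc (by rintro u (⟨i, -, rfl⟩ | ⟨i, -, rfl⟩) <;> exact hvK i)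
    (hvK t) ht
  have hm' : ∃ i, v i = v t ∧ (b ≤ i ∧ i ≤ c ∨ d ≤ i ∧ i ≤ a + 2 * s) := by
    rcases hm with ⟨i, ⟨hi1, hi2⟩, hi⟩ | ⟨i, ⟨hi1, hi2⟩, hi⟩
    · exact ⟨i, hi, Or.inl ⟨hi1, hi2⟩⟩
    · exact ⟨i, hi, Or.inr ⟨hi1, by push_cast at hi2; exact hi2⟩⟩
  obtain ⟨i, hi, h⟩ := hm'
  constructor
  · rintro ⟨g1, g2⟩
    have := hv.inj _ _ hi (by omega) (by omega)
    omega
  · rintro ⟨g1, g2⟩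
    have := hv.inj _ _ hi (by omega) (by omega)
    omega

/-- Two crossing chords form an even cycle with either pair of opposite arcs. The two cycles share
only the four chord ends, and both contain every attached vertex. -/
theorem chord_cr (hv : G.IsCyc (2 * s) v) (hvK : ∀ i, v i ∉ K) {a b c d : ℤ}
    (hab : G.Adj (v a) (v b)) (hcd : G.Adj (v c) (v d)) (h1 : a < c) (h2 : c < b) (h3 : b < d)
    (h4 : d < a + 2 * s) (hev : (b - a) % 2 = 0)
    (hev' : (d - c) % 2 = 0) (t : ℤ) (ht : G.Att K (v t)) (hta : a ≤ t) (hta' : t < a + 2 * s) :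
    t = a ∨ t = b ∨ t = c ∨ t = d := by
  have p1 := hv.arc' h1.le (by omega)
  have p2 := hv.arc' h3.le (by omega)
  have p := p1.join hcd p2.symm (by
    rintro _ ⟨i, ⟨hi1, hi2⟩, rfl⟩ ⟨j, ⟨hj1, hj2⟩, hij⟩
    have := hv.inj _ _ hij (by omega) (by omega)
    omega)
  have hc := p.closeAdj hab (by omega)
  have hm := hK.mem _ _ (v t) (by omega) hc (by rintro u (⟨i, -, rfl⟩ | ⟨i, -, rfl⟩) <;> exact hvK i)
    (hvK t) ht
  have p1' := hv.arc' h2.le (by omega)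
  have p2' := hv.arc' (i := d) (j := a + (2 * s : ℕ)) (by push_cast; omega) (by omega)
  rw [hv.period] at p2'
  have p' := p1'.symm.join hcd p2' (by
    rintro _ ⟨i, ⟨hi1, hi2⟩, rfl⟩ ⟨j, ⟨hj1, hj2⟩, hij⟩
    have := hv.inj _ _ hij (by omega) (by omega)
    omega)
  have hc' := p'.closeAdj hab.symm (by omega)
  have hm' := hK.mem _ _ (v t) (by omega) hc'
    (by rintro u (⟨i, -, rfl⟩ | ⟨i, -, rfl⟩) <;> exact hvK i) (hvK t) ht
  have e1 : ∃ i, v i = v t ∧ (a ≤ i ∧ i ≤ c ∨ b ≤ i ∧ i ≤ d) := by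
    rcases hm with ⟨i, ⟨hi1, hi2⟩, hi⟩ | ⟨i, ⟨hi1, hi2⟩, hi⟩
    · exact ⟨i, hi, Or.inl ⟨hi1, hi2⟩⟩
    · exact ⟨i, hi, Or.inr ⟨hi1, hi2⟩⟩
  have e2 : ∃ i, v i = v t ∧ (c ≤ i ∧ i ≤ b ∨ d ≤ i ∧ i ≤ a + 2 * s) := by
    rcases hm' with ⟨i, ⟨hi1, hi2⟩, hi⟩ | ⟨i, ⟨hi1, hi2⟩, hi⟩
    · exact ⟨i, hi, Or.inl ⟨hi1, hi2⟩⟩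
    · exact ⟨i, hi, Or.inr ⟨hi1, by push_cast at hi2; exact hi2⟩⟩
  obtain ⟨i, hi, h⟩ := e1
  obtain ⟨j, hj, h'⟩ := e2
  have := hv.inj _ _ hi (by omega) (by omega)
  by_cases hja : j = a + 2 * s
  · subst hja
    have hj' : v a = v t := by
      rw [← hj, ← hv.period a]; push_cast; rfl
    have := hv.inj _ _ hj' (by omega) (by omega)
    omega
  · have := hv.inj _ _ hj (by omega) (by omega)
    omega

theorem three_att (hG : G.TriConn) (hv : G.IsCyc (2 * s) v) (hvK : ∀ i, v i ∉ K) (a b : ℤ) :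
    ∃ t : ℤ, 0 ≤ t ∧ t < 2 * s ∧ G.Att K (v t) ∧ t ≠ a ∧ t ≠ b := by
  have h3 := hv.three_le
  obtain ⟨k₀, hk₀⟩ := hK.nonempty
  obtain ⟨z, hz, hza, hzb⟩ : ∃ z, z ∉ K ∧ z ≠ v a ∧ z ≠ v b := by
    by_contra! hcon
    have e1 := hcon _ (hvK (a + 1)) (hv.adj a).ne'
    have e2 := hcon _ (hvK (a + 2)) (fun h => by have := hv.inj _ _ h (by omega) (by omega); omega)
    have := hv.inj _ _ (e1.trans e2.symm) (by omega) (by omega)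
    omega
  obtain ⟨k, hk, u, hu, hku, h1, h2, -, -⟩ := hG.exists_cross K (a := v a) (b := v b) hk₀ hz
    (fun h => hvK a (h ▸ hk₀)) (fun h => hvK b (h ▸ hk₀)) hza hzb
  rcases hK.cover hG hv hvK u with h | ⟨i, rfl⟩
  · exact (hu h).elim
  obtain ⟨t, g1, g2, g3⟩ := hv.exists_rep 0 i
  exact ⟨t, g1, by omega, ⟨k, hk, g3 ▸ hku⟩, fun h => h1 (by rw [← g3, h]),
    fun h => h2 (by rw [← g3, h])⟩

theorem chord_of_not_att (hG : G.TriConn) (hv : G.IsCyc (2 * s) v) (hvK : ∀ i, v i ∉ K) (i : ℤ)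
    (hi : ¬ G.Att K (v i)) : ∃ j, G.Adj (v i) (v j) ∧ i + 2 ≤ j ∧ j + 2 ≤ i + 2 * s := by
  obtain ⟨u, hu, h1, h2⟩ := hG.exists_adj (v i) (v (i + 1)) (v (i - 1))
  rcases hK.cover hG hv hvK u with h | ⟨j', rfl⟩
  · exact (hi ⟨u, h, hu.symm⟩).elim
  obtain ⟨j, g1, g2, g3⟩ := hv.exists_rep i j'
  rw [← g3] at hu h1 h2
  refine ⟨j, hu, ?_, ?_⟩
  · by_contra hlt
    rcases (show j = i ∨ j = i + 1 by omega) with rfl | rfl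
    · exact hu.ne rfl
    · exact h1 rfl
  · by_contra hlt
    obtain rfl : j = i - 1 + (2 * s : ℕ) := by push_cast; omega
    exact h2 (hv.period _)

/-- An even cycle with exactly one chord, in which the middle of one side and a vertex next to the
middle of the other side are attached. -/
theorem win_of_chord (hv : G.IsCyc (2 * s) v) (hvK : ∀ i, v i ∉ K) (hs : 3 ≤ s) {k : ℤ}
    (hadj : G.Adj (v 0) (v k)) (hk2 : 2 ≤ k) (hks : k ≤ s) (hk : k % 2 = 0)
    (hT : ∀ t : ℤ, 0 < t → t < 2 * s → t ≠ k → G.Att K (v t)) : G.Win := by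
  obtain ⟨a, rfl⟩ : ∃ a, k = 2 * a := ⟨k / 2, by omega⟩
  obtain ⟨x, hx, hxa⟩ := hT a (by omega) (by omega) (by omega)
  obtain ⟨y, hy, hya⟩ := hT (a + s + 1) (by omega) (by omega) (by omega)
  obtain ⟨m, hm⟩ := hK.conn.exists_pathIn hx hy
  have hne : v a ≠ v (a + s + 1) := fun h => by
    have := hv.inj _ _ h (by omega) (by omega); omega
  have hp := hm.ends hxa.symm hya.symm hne (hvK _) (hvK _)
  have hd : ∀ u, u ∈ insert (v a) (insert (v (a + s + 1)) K) → ∀ T : Set V, T ⊆ Set.range v →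
      u ∈ T → u = v a ∨ u = v (a + s + 1) := by
    rintro u (rfl | rfl | h) T hT hu
    · exact Or.inl rfl
    · exact Or.inr rfl
    · obtain ⟨t, rfl⟩ := hT hu
      exact (hvK t h).elim
  -- The arcs between `v a` and `v (a + s + 1)` have lengths `s - 1` and `s + 1`; the two routes
  -- through the chord have lengths `s` and `s + 2`. One of these pairs fits the parity of the path
  -- through `K`.
  by_cases hpar : (m + s) % 2 = 1
  · have r1 := hv.arc_range (i := a) (j := a + s + 1) (by omega) (by omega)
    have r2 := hv.arc_range' (i := a) (j := a + s + 1) (by omega) (by omega)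
    exact hp.win r2 r1 (by omega) (by omega) (by omega) hne (fun u h1 h2 => hd u h1 _ subset_rfl h2)
      (fun u h1 h2 => hd u h1 _ subset_rfl h2)
  · have p1 := hv.arc' (i := 0) (j := a) (by omega) (by omega)
    have p2 := hv.arc' (i := 2 * a) (j := a + s + 1) (by omega) (by omega)
    have r2 := p1.symm.join hadj p2 (by
      rintro _ ⟨i, ⟨hi1, hi2⟩, rfl⟩ ⟨j, ⟨hj1, hj2⟩, hij⟩
      have := hv.inj _ _ hij (by omega) (by omega)
      omega)
    have q1 := hv.arc' (i := a) (j := 2 * a) (by omega) (by omega)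
    have q2 := hv.arc' (i := a + s + 1) (j := 0 + (2 * s : ℕ)) (by push_cast; omega) (by omega)
    rw [hv.period] at q2
    have r1 := q1.join hadj.symm q2.symm (by
      rintro _ ⟨i, ⟨hi1, hi2⟩, rfl⟩ ⟨j, ⟨hj1, hj2⟩, hij⟩
      have := hv.inj _ _ hij (by push_cast at *; omega) (by push_cast at *; omega)
      omega)
    refine hp.win r1 r2 (by push_cast; omega) (by push_cast; omega) (by omega) hne
      (fun u h1 h2 => hd u h1 _ ?_ h2) (fun u h1 h2 => hd u h1 _ ?_ h2)
    all_goals exact Set.union_subset (Set.image_subset_range _ _) (Set.image_subset_range _ _)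

/-- By degree three an unattached vertex carries a chord. With a smallest cap rotated to start at 0,
`chords_unique` shows every vertex other than its two ends to be attached, which is what
`win_of_chord` needs. -/
theorem att_or_win (hG : G.TriConn) (hv : G.IsCyc (2 * s) v) (hvK : ∀ i, v i ∉ K) (hs : 3 ≤ s)
    (i₀ : ℤ) (hi₀ : ¬ G.Att K (v i₀)) : G.Win := by
  -- a chord with the smallest cap
  have hex : ∃ l : ℕ, ∃ i j : ℤ, G.Adj (v i) (v j) ∧ i + 2 ≤ j ∧ j + 2 ≤ i + 2 * s ∧ j - i = l := by
    obtain ⟨j, h1, h2, h3⟩ := hK.chord_of_not_att hG hv hvK i₀ hi₀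
    exact ⟨(j - i₀).toNat, i₀, j, h1, h2, h3, by omega⟩
  classical
  obtain ⟨i₁, j₁, g1, g2, g3, g4⟩ := Nat.find_spec hex
  have hmin := fun l h => Nat.find_min' hex (m := l) h
  set l := Nat.find hex
  have hw := hv.shift i₁
  set w : ℤ → V := fun i => v (i + i₁) with hwdef
  have hwK : ∀ i, w i ∉ K := fun i => hvK _
  set C : ℤ → ℤ → Prop := fun i j => G.Adj (w i) (w j) ∧ i + 2 ≤ j ∧ j + 2 ≤ i + 2 * s with hC
  have hev : ∀ i j, C i j → (j - i) % 2 = 0 := fun i j h => hK.chord_even hG hw hwK h.2.1 h.2.2 h.1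
  have hper : ∀ i, w (i + 2 * s) = w i := fun i => by
    have := hw.period i; push_cast at this; exact this
  have h0l : C 0 l := by
    refine ⟨?_, by omega, by omega⟩
    simp only [hwdef]
    rwa [show 0 + i₁ = i₁ by ring, show (l : ℤ) + i₁ = j₁ by omega]
  have hCmin : ∀ i j, C i j → (l : ℤ) ≤ j - i := by
    intro i j h
    have := hmin (j - i).toNat ⟨i + i₁, j + i₁, h.1, by have := h.2.1; omega, by have := h.2.2; omega,
      by have := h.2.1; omega⟩
    have := h.2.1
    omega
  have hrot : ∀ i j, C i j → C j (i + 2 * s) := by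
    intro i j h
    exact ⟨by rw [hper]; exact h.1.symm, by have := h.2.2; omega, by have := h.2.1; omega⟩
  have hl : (l : ℤ) ≤ s := by
    have := hCmin _ _ (hrot _ _ h0l)
    omega
  have huniq := chords_unique (s : ℤ) (by exact_mod_cast hs) (fun t => G.Att K (w t)) C
    (fun i => by rw [hper]) (fun i j h => ⟨h.2.1, h.2.2, hev i j h⟩) hrot
    (fun i j h => ⟨by have := h.1; rwa [hper, hper] at this, by have := h.2.1; omega,
      by have := h.2.2; omega⟩)
    (fun i hi => hK.chord_of_not_att hG hw hwK i hi)
    (fun a b c d hab hcd h1 h2 h3 t ht => hK.chord_nc hw hwK hab.1 hcd.1 (by have := hab.2.1; omega)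
      h1 (by have := hcd.2.1; omega) h2 h3 (hev _ _ hab) (hev _ _ hcd) t ht)
    (fun a b c d hab hcd h1 h2 h3 h4 t ht h5 h6 => hK.chord_cr hw hwK hab.1 hcd.1 h1 h2 h3 h4
      (hev _ _ hab) (hev _ _ hcd) t ht h5 h6)
    (hK.three_att hG hw hwK) l h0l hCmin
  have h0l2 := h0l.2.1
  exact hK.win_of_chord hw hwK hs h0l.1 (by omega) hl (by have := hev _ _ h0l; omega) huniq

end MaxEven

/-- Either there are cycles of consecutive even lengths, or the complement of a suitable connected
set is an even cycle with all its vertices attached to that set (up to one in a 4-cycle). -/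
theorem TriConn.exists_even_complement [Finite V] (hG : G.TriConn) {K₀ : Set V}
    (hK₀ : G.ConnOn K₀) (hne : K₀.Nonempty) {n : ℕ} (hn : n % 2 = 0) (hc : G.CycIn K₀ᶜ n) :
    G.Win ∨ ∃ (K : Set V) (s : ℕ) (v : ℤ → V), K₀ ⊆ K ∧ G.ConnOn K ∧ 2 ≤ s ∧ G.IsCyc (2 * s) v ∧
      (∀ u, u ∈ K ∨ u ∈ Set.range v) ∧ (∀ i, v i ∉ K) ∧
      ((∀ i, G.Att K (v i)) ∨
        s = 2 ∧ G.Att K (v 0) ∧ G.Att K (v 1) ∧ G.Att K (v 2)) := by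
  obtain ⟨K, hsub, hK, m, hm, hcyc⟩ := exists_maxEven hK₀ hne hn hc
  obtain ⟨v, hv, hvK⟩ := hcyc.exists_isCyc
  replace hvK : ∀ i, v i ∉ K := fun i => hvK ⟨i, rfl⟩
  obtain ⟨s, rfl⟩ : ∃ s, m = 2 * s := ⟨m / 2, by omega⟩
  have h3 := hv.three_le
  by_cases hall : ∀ i, G.Att K (v i)
  · exact Or.inr ⟨K, s, v, hsub, hK.conn, by omega, hv, hK.cover hG hv hvK, hvK, Or.inl hall⟩
  push Not at hall
  obtain ⟨i₀, hi₀⟩ := hall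
  by_cases hs : 3 ≤ s
  · exact Or.inl (hK.att_or_win hG hv hvK hs i₀ hi₀)
  obtain rfl : s = 2 := by omega
  -- The rotation moves the unattached vertex of the 4-cycle to position 3.
  have hw := hv.shift (i₀ + 1)
  refine Or.inr ⟨K, 2, _, hsub, hK.conn, le_rfl, hw, hK.cover hG hw (fun i => hvK _), fun i => hvK _,
    Or.inr ⟨rfl, ?_⟩⟩
  have h3' : ¬ G.Att K (v (3 + (i₀ + 1))) := by
    have := hv.period i₀
    rw [show 3 + (i₀ + 1) = i₀ + (2 * 2 : ℕ) by push_cast; ring, this]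
    exact hi₀
  exact attached_of_four (T := fun t => G.Att K (v (t + (i₀ + 1))))
    (hK.three_att hG hw (fun i => hvK _)) (d := 3)
    (fun t _ h1 h2 => by push_cast at h2; omega) h3'

/-! ### Longest paths and acyclic sets -/

theorem PathIn.lt_card [Finite V] {S : Set V} {x y : V} {n : ℕ} (h : G.PathIn S x y n) :
    n < Nat.card V := by
  obtain ⟨q, -, -, -, hi, -⟩ := h
  have := Nat.card_le_card_of_injective (fun i : Fin (n + 1) => q i)
    (fun i j hij => Fin.ext (hi i (by omega) j (by omega) hij))
  rw [Nat.card_eq_fintype_card, Fintype.card_fin] at this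
  omega

theorem exists_longest_path [Finite V] {U : Set V} (hU : U.Nonempty) :
    ∃ n x y, G.PathIn U x y n ∧ ∀ m x' y', G.PathIn U x' y' m → m ≤ n := by
  classical
  obtain ⟨u, hu⟩ := hU
  let P : ℕ → Prop := fun n => ∃ x y, G.PathIn U x y n
  have hb : ∀ n, P n → n ≤ Nat.card V := fun n ⟨x, y, h⟩ => h.lt_card.le
  have h0 : P 0 := ⟨u, u, PathIn.single hu⟩
  obtain ⟨x, y, hxy⟩ := Nat.findGreatest_spec (P := P) (Nat.zero_le (Nat.card V)) h0
  exact ⟨_, x, y, hxy, fun m x' y' h => Nat.le_findGreatest (hb m ⟨x', y', h⟩) ⟨x', y', h⟩⟩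

/-- In a set without cycles, the end of a longest path has no neighbour off the path. -/
theorem PathIn.longest_end {U : Set V} (hac : ∀ n, ¬ G.CycIn U n) {x y : V} {n : ℕ}
    (h : G.PathIn U x y (n + 1)) (hl : ∀ m x' y', G.PathIn U x' y' m → m ≤ n + 1) :
    ∃ w, G.Adj x w ∧ G.PathIn (U \ {x}) w y n ∧ ∀ z ∈ U, G.Adj x z → z = w := by
  obtain ⟨q, h0, hn, ha, hi, hS⟩ := h
  subst h0 hn
  refine ⟨q 1, ha 0 (by omega), ⟨fun i => q (i + 1), rfl, rfl, fun i hi => ha _ (by omega),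
    fun i h1 j h2 h3 => ?_, fun i h1 => ⟨hS _ (by omega), fun h => ?_⟩⟩, fun z hz hxz => ?_⟩
  · have := hi _ (by omega) _ (by omega) h3
    omega
  · have := hi (i + 1) (by omega) 0 (by omega) h
    omega
  · by_cases hzq : ∃ j ≤ n + 1, q j = z
    · obtain ⟨j, hj, rfl⟩ := hzq
      by_contra hne
      have hj0 : j ≠ 0 := fun h => hxz.ne (h ▸ rfl)
      have hj1 : j ≠ 1 := fun h => hne (h ▸ rfl)
      have hp : G.PathIn U (q 0) (q j) j := ⟨q, rfl, rfl, fun i h => ha i (by omega),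
        fun i h k h' => hi i (by omega) k (by omega), fun i h => hS i (by omega)⟩
      exact hac _ (hp.closeAdj hxz (by omega))
    · push Not at hzq
      have hp : G.PathIn (U \ {z}) (q 0) (q (n + 1)) (n + 1) := ⟨q, rfl, rfl, ha, hi, fun i h =>
        ⟨hS i h, hzq i h⟩⟩
      have := hl _ _ _ ((hp.cons hxz.symm (by simp)).mono (by
        rintro u (rfl | hu)
        · exact hz
        · exact hu.1))
      omega

theorem exists_cycIn [Finite V] {U : Set V} (hU : U.Nonempty)
    (h : ∀ x ∈ U, ∀ a, ∃ y ∈ U, G.Adj x y ∧ y ≠ a) : ∃ n, G.CycIn U n := by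
  by_contra! hac
  obtain ⟨n, x, y, hp, hl⟩ := exists_longest_path (G := G) hU
  cases n with
  | zero =>
    obtain ⟨z, hz, hxz, -⟩ := h x hp.left_mem x
    have := hl _ _ _ ((PathIn.single (G := G) (Set.mem_singleton z)).cons hxz (by simpa using hxz.ne)
      |>.mono (by
        rintro u (rfl | rfl)
        · exact hp.left_mem
        · exact hz))
    omega
  | succ n =>
    obtain ⟨w, -, -, hw⟩ := hp.longest_end hac hl
    obtain ⟨z, hz, hxz, hzw⟩ := h x hp.left_mem w
    exact hzw (hw z hz hxz)

/-! ### Graphs without odd cycles -/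

/-- The two arcs between almost opposite vertices of an even cycle, closed up by a path outside. -/
theorem IsCyc.win_of_outside {K : Set V} {s : ℕ} {v : ℤ → V} (hv : G.IsCyc (2 * s) v) (hs : 2 ≤ s)
    (hvK : ∀ i, v i ∉ K) {x y : V} {m : ℕ} (hm : G.PathIn K x y m) {i : ℤ} (hx : G.Adj (v i) x)
    (hy : G.Adj (v (i + s + 1)) y) (hpar : (m + s) % 2 = 1) : G.Win := by
  have hne : v i ≠ v (i + s + 1) := fun h => by
    have := hv.inj _ _ h (by omega) (by omega); omega
  have hp := hm.ends hx hy hne (hvK _) (hvK _)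
  have hd : ∀ u, u ∈ insert (v i) (insert (v (i + s + 1)) K) → u ∈ Set.range v →
      u = v i ∨ u = v (i + s + 1) := by
    rintro u (rfl | rfl | h) hu
    · exact Or.inl rfl
    · exact Or.inr rfl
    · obtain ⟨t, rfl⟩ := hu
      exact (hvK t h).elim
  have r1 := hv.arc_range (i := i) (j := i + s + 1) (by omega) (by omega)
  have r2 := hv.arc_range' (i := i) (j := i + s + 1) (by omega) (by omega)
  exact hp.win r2 r1 (by omega) (by omega) (by omega) hne hd hd

/-- A wrong parity in `win_of_outside` would create an odd cycle, so two attached vertices at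
positions `i` and `i + s + 1` suffice. In a 4-cycle with one vertex unattached, positions 1 and 4
serve, the latter being `v 0`. -/
theorem TriConn.win_of_bipartite [Finite V] (hG : G.TriConn)
    (hodd : ∀ n, n % 2 = 1 → ¬ G.CycIn Set.univ n) : G.Win := by
  obtain ⟨x, -⟩ := hG.many ∅ (by simp)
  obtain ⟨y, hy⟩ := hG.many {x} (by simp)
  obtain ⟨n, hn⟩ := exists_cycIn (G := G) (U := {x}ᶜ) ⟨y, by simpa using hy⟩ (by
    intro z _ a
    obtain ⟨u, h1, h2, h3⟩ := hG.exists_adj z x a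
    exact ⟨u, h2, h1, h3⟩)
  have hn2 : n % 2 = 0 := by
    by_contra h
    exact hodd n (by omega) (hn.mono (Set.subset_univ _))
  have hx : G.ConnOn {x} := by
    rintro a rfl b rfl
    exact Reach.refl rfl
  rcases hG.exists_even_complement hx ⟨x, rfl⟩ hn2 hn with h | ⟨K, s, v, -, hK, hs, hv, -, hvK, hatt⟩
  · exact h
  have main : ∀ i : ℤ, G.Att K (v i) → G.Att K (v (i + s + 1)) → G.Win := by
    rintro i ⟨a, ha, hai⟩ ⟨b, hb, hbi⟩
    obtain ⟨m, hm⟩ := hK.exists_pathIn ha hb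
    refine hv.win_of_outside hs hvK hm hai.symm hbi.symm ?_
    by_contra hpar
    have hne : v i ≠ v (i + s + 1) := fun h => by
      have := hv.inj _ _ h (by omega) (by omega); omega
    have hp := hm.ends hai.symm hbi.symm hne (hvK _) (hvK _)
    have r := hv.arc_range (i := i) (j := i + s + 1) (by omega) (by omega)
    refine hodd _ ?_ ((hp.close r ?_ (by omega) (by omega)).mono (Set.subset_univ _))
    · omega
    · rintro u (rfl | rfl | h) hu
      · exact Or.inl rfl
      · exact Or.inr rfl
      · obtain ⟨t, rfl⟩ := hu
        exact (hvK t h).elim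
  rcases hatt with hatt | ⟨rfl, h0, h1, h2⟩
  · exact main 0 (hatt _) (hatt _)
  · refine main 1 h1 ?_
    rw [show (1 : ℤ) + (2 : ℕ) + 1 = 0 + (2 * 2 : ℕ) by norm_num, hv.period]
    exact h0

/-! ### An odd cycle disjoint from an even cycle -/

/-- Any two vertices of `L` are joined inside `L` by paths of both parities. -/
def BothPar (G : SimpleGraph V) (L : Set V) : Prop :=
  ∀ u ∈ L, ∀ w ∈ L, u ≠ w → ∀ b : ℕ, ∃ n, (n + b) % 2 = 0 ∧ G.PathIn L u w n

theorem IsCyc.bothPar {n : ℕ} {v : ℤ → V} (hv : G.IsCyc n v) (hn : n % 2 = 1) :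
    G.BothPar (Set.range v) := by
  rintro _ ⟨i, rfl⟩ _ ⟨j, rfl⟩ hne b
  obtain ⟨k, h1, h2, h3⟩ := hv.exists_rep i j
  rw [← h3] at hne ⊢
  have hik : i ≠ k := fun h => hne (h ▸ rfl)
  by_cases hb : ((k - i).toNat + b) % 2 = 0
  · exact ⟨_, hb, hv.arc_range h1 h2⟩
  · exact ⟨_, by omega, hv.arc_range' (by omega) h2.le⟩

/-- Ears with distinct feet preserve the property. A vertex of `L` enters the ear through a foot
other than itself, and two ear vertices are joined the long way round through `L`; the parity is
adjusted inside `L`. -/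
theorem BothPar.ear {L S : Set V} (hL : G.BothPar L) {g g' x y : V} {m : ℕ} (hg : g ∈ L)
    (hg' : g' ∈ L) (hgg : g ≠ g') (hp : G.PathIn S x y m) (hd : ∀ u ∈ S, u ∉ L)
    (hx : G.Adj g x) (hy : G.Adj g' y) : ∃ T ⊆ S, T.Nonempty ∧ G.BothPar (L ∪ T) := by
  obtain ⟨q, h0, hm, ha, hi, hS⟩ := hp
  subst h0 hm
  have seg : ∀ i j, i ≤ j → j ≤ m → G.PathIn (q '' Set.Icc i j) (q i) (q j) (j - i) := by
    intro i j hij hj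
    refine ⟨fun t => q (i + t), rfl, by simp only [show i + (j - i) = j by omega],
      fun t h => ha (i + t) (by omega), fun t h t' h' hh => ?_,
      fun t h => ⟨i + t, ⟨by omega, by omega⟩, rfl⟩⟩
    have := hi _ (by omega) _ (by omega) hh
    omega
  have hdis : ∀ i j, j ≤ m → ∀ u, u ∈ L → u ∈ q '' Set.Icc i j → False := by
    rintro i j hj _ hu ⟨t, ⟨h1, h2⟩, rfl⟩
    exact hd _ (hS t (by omega)) hu
  have hsub : ∀ i j, j ≤ m → q '' Set.Icc i j ⊆ L ∪ q '' Set.Icc 0 m := by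
    rintro i j hj _ ⟨t, ⟨h1, h2⟩, rfl⟩
    exact Or.inr ⟨t, ⟨by omega, by omega⟩, rfl⟩
  have hLsub : L ⊆ L ∪ q '' Set.Icc 0 m := Set.subset_union_left
  have mixed : ∀ u ∈ L, ∀ i ≤ m, ∀ b : ℕ, ∃ n, (n + b) % 2 = 0 ∧
      G.PathIn (L ∪ q '' Set.Icc 0 m) u (q i) n := by
    intro u hu i him b
    by_cases hug : u = g
    · obtain ⟨l, hl, hpl⟩ := hL u hu g' hg' (hug ▸ hgg) (b + 1 + (m - i))
      exact ⟨_, by omega, (hpl.join hy (seg i m him le_rfl).symm (hdis _ _ le_rfl)).mono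
        (Set.union_subset hLsub (hsub _ _ le_rfl))⟩
    · obtain ⟨l, hl, hpl⟩ := hL u hu g hg hug (b + 1 + (i - 0))
      exact ⟨_, by omega, (hpl.join hx (seg 0 i (Nat.zero_le _) him) (hdis _ _ him)).mono
        (Set.union_subset hLsub (hsub _ _ him))⟩
  have inner : ∀ i j, i < j → j ≤ m → ∀ b : ℕ, ∃ n, (n + b) % 2 = 0 ∧
      G.PathIn (L ∪ q '' Set.Icc 0 m) (q i) (q j) n := by
    intro i j hij hj b
    obtain ⟨l, hl, hpl⟩ := hL g hg g' hg' hgg (b + (i - 0) + (m - j))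
    have p1 := (seg 0 i (Nat.zero_le _) (by omega)).symm.join hx.symm hpl
      (fun u h1 h2 => hdis 0 i (by omega) u h2 h1)
    have p2 := p1.join hy (seg j m hj le_rfl).symm (by
      rintro u (⟨t, ⟨h1, h2⟩, rfl⟩ | h) hu
      · obtain ⟨t', ⟨h3, h4⟩, h5⟩ := hu
        have := hi _ (by omega) _ (by omega) h5
        omega
      · exact hdis _ _ le_rfl u h hu)
    exact ⟨_, by omega, p2.mono (Set.union_subset (Set.union_subset (hsub _ _ (by omega)) hLsub)
      (hsub _ _ le_rfl))⟩
  refine ⟨q '' Set.Icc 0 m, ?_, ⟨q 0, 0, ⟨le_rfl, Nat.zero_le _⟩, rfl⟩, ?_⟩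
  · rintro _ ⟨t, ⟨h1, h2⟩, rfl⟩
    exact hS t h2
  rintro u (hu | ⟨i, ⟨-, hi'⟩, rfl⟩) w (hw | ⟨j, ⟨-, hj'⟩, rfl⟩) hne b
  · obtain ⟨n, h1, h2⟩ := hL u hu w hw hne b
    exact ⟨n, h1, h2.mono hLsub⟩
  · exact mixed u hu j hj' b
  · obtain ⟨n, h1, h2⟩ := mixed w hw i hi' b
    exact ⟨n, h1, h2.symm⟩
  · rcases lt_trichotomy i j with h | h | h
    · exact inner i j h hj' b
    · exact (hne (h ▸ rfl)).elim
    · obtain ⟨n, h1, h2⟩ := inner j i h hi' b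
      exact ⟨n, h1, h2.symm⟩

/-- The vertex `g ∈ L` is the first vertex of `L` on some way from `x` through `K`. -/
def Gate (G : SimpleGraph V) (K L : Set V) (x g : V) : Prop :=
  g ∈ L ∧ (G.Adj x g ∨ ∃ k k', G.Adj x k ∧ G.Reach (K \ L) k k' ∧ G.Adj k' g)

theorem ConnOn.exists_gate {K L : Set V} (hK : G.ConnOn K) (hLK : L ⊆ K) (hL : L.Nonempty) {x : V}
    (hx : G.Att K x) : ∃ g, G.Gate K L x g := by
  obtain ⟨k, hk, hkx⟩ := hx
  obtain ⟨l, hl⟩ := hL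
  by_cases hkL : k ∈ L
  · exact ⟨k, hkL, Or.inl hkx.symm⟩
  · obtain ⟨a, b, h1, h2, h3, h4⟩ := (hK k hk l (hLK hl)).exit Lᶜ hkL (by simpa using hl)
    exact ⟨b, by simpa using h4, Or.inr ⟨k, a, hkx.symm, h1, h2⟩⟩

theorem Gate.exists_pathIn {K L : Set V} (hLK : L ⊆ K) {x g : V} (h : G.Gate K L x g) :
    ∃ k A l, G.Adj x k ∧ G.PathIn A k g l ∧ A ⊆ K ∧
      ∀ u ∈ A, u ≠ g → u ∉ L ∧ ∃ k', G.Reach (K \ L) u k' ∧ G.Adj k' g := by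
  obtain ⟨hg, h | ⟨k, k', h1, h2, h3⟩⟩ := h
  · exact ⟨g, {g}, 0, h, PathIn.single rfl, by simpa using hLK hg,
      fun u hu hne => (hne hu).elim⟩
  · obtain ⟨l, hl⟩ := (connOn_comp (G := G) (S := K \ L) (x := k)).exists_pathIn
      (mem_comp_self h2.1) h2
    refine ⟨k, _, _, h1, hl.snoc h3 (fun h => (comp_subset h).2 hg), ?_, ?_⟩
    · rintro u (rfl | hu)
      · exact hLK hg
      · exact (comp_subset hu).1
    · rintro u (rfl | hu) hne
      · exact (hne rfl).elim
      · exact ⟨(comp_subset hu).2, k', Reach.trans (Reach.symm hu) h2, h3⟩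

/-- By `hear` the two approaches to distinct gates cannot meet outside `L`, so they can be linked by
a path of `L` of either parity. -/
theorem Gate.exists_parity {K L : Set V} (hLK : L ⊆ K) (hL : G.BothPar L)
    (hear : ∀ h h' g g', G.Reach (K \ L) h h' → g ∈ L → g' ∈ L → G.Adj h g → G.Adj h' g' → g = g')
    {x y g g' : V} (hx : G.Gate K L x g) (hy : G.Gate K L y g') (hgg : g ≠ g') (b : ℕ) :
    ∃ k k' n, G.Adj x k ∧ G.Adj y k' ∧ (n + b) % 2 = 0 ∧ G.PathIn K k k' n := by
  obtain ⟨k, A, l, hxk, hA, hAK, hA'⟩ := hx.exists_pathIn hLK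
  obtain ⟨k', B, l', hyk, hB, hBK, hB'⟩ := hy.exists_pathIn hLK
  obtain ⟨n, hn, hp⟩ := hL g hx.1 g' hy.1 hgg (b + l + l')
  have p1 := hA.append hp (fun u h1 h2 => by
    by_contra hne
    exact (hA' u h1 hne).1 h2)
  have p2 := p1.append hB.symm (fun u h1 h2 => by
    by_contra hne
    obtain ⟨g1, k2, g2, g3⟩ := hB' u h2 hne
    rcases h1 with h1 | h1
    · obtain ⟨f1, k1, f2, f3⟩ := hA' u h1 (fun h => g1 (h ▸ hx.1))
      exact hgg (hear k1 k2 g g' (f2.symm.trans g2) hx.1 hy.1 f3 g3)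
    · exact g1 h1)
  exact ⟨k, k', _, hxk, hyk, by omega, p2.mono (Set.union_subset (Set.union_subset hAK hLK) hBK)⟩

/-- Gates at `i` and `i + s + 1` agree. Two such moves shift by `2s + 2`, which is 2 on the cycle,
so gates have period 2. For `s = 2` one move goes to the preceding position, and three attached
vertices already force a single gate. -/
theorem gate_cases {K L : Set V} {s : ℕ} {v : ℤ → V} (hv : G.IsCyc (2 * s) v)
    (H : ∀ i g g', G.Gate K L (v i) g → G.Gate K L (v (i + s + 1)) g' → g = g')
    (hex : ∀ i, G.Att K (v i) → ∃ g, G.Gate K L (v i) g)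
    (hatt : (∀ i, G.Att K (v i)) ∨ s = 2 ∧ G.Att K (v 0) ∧ G.Att K (v 1) ∧ G.Att K (v 2)) :
    ∃ γ₀ ∈ L, ∃ γ₁ ∈ L, ∀ i g, G.Gate K L (v i) g → g = γ₀ ∨ g = γ₁ := by
  have hper : ∀ i, v (i + 2 * s) = v i := fun i => by
    have := hv.period i; push_cast at this; exact this
  rcases hatt with hatt | ⟨rfl, h0, h1, h2⟩
  · choose γ hγ using fun i => hex i (hatt i)
    have e1 : ∀ i g, G.Gate K L (v i) g → g = γ (i + s + 1) := fun i g hg => H i g _ hg (hγ _)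
    have e2 : ∀ i g, G.Gate K L (v (i + 2)) g → γ (i + s + 1) = g := fun i g hg =>
      H (i + s + 1) _ g (hγ _) (by
        rwa [show i + s + 1 + s + 1 = i + 2 + 2 * s by ring, hper])
    have e3 : Function.Periodic γ 2 := fun i => by
      rw [← e2 i _ (hγ _), ← e1 i _ (hγ _)]
    have e4 : ∀ i g, G.Gate K L (v i) g → g = γ i := fun i g hg => by
      rw [e1 i g hg, ← e1 i _ (hγ _)]
    refine ⟨γ 0, (hγ 0).1, γ 1, (hγ 1).1, fun i g hg => ?_⟩
    rw [e4 i g hg]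
    have e5 := e3.int_mul (i / 2) (i % 2)
    rw [Int.cast_id, show i % 2 + i / 2 * 2 = i by omega] at e5
    rcases Int.emod_two_eq_zero_or_one i with h | h
    · exact Or.inl (by rw [e5, h])
    · exact Or.inr (by rw [e5, h])
  · obtain ⟨a, ha⟩ := hex 0 h0
    obtain ⟨b, hb⟩ := hex 1 h1
    obtain ⟨c, hc⟩ := hex 2 h2
    have p0 : v (1 + (2 : ℕ) + 1) = v 0 := by have := hper 0; norm_num at this ⊢; exact this
    have p1 : v (2 + (2 : ℕ) + 1) = v 1 := by have := hper 1; norm_num at this ⊢; exact this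
    have p2 : v (3 + (2 : ℕ) + 1) = v 2 := by have := hper 2; norm_num at this ⊢; exact this
    have hba : b = a := H 1 b a hb (by rwa [p0])
    have hcb : c = b := H 2 c b hc (by rwa [p1])
    refine ⟨b, hb.1, b, hb.1, fun i g hg => ?_⟩
    rw [or_self]
    obtain ⟨j, j1, j2, j3⟩ := hv.exists_rep 0 i
    rw [← j3] at hg
    rcases (show j = 0 ∨ j = 1 ∨ j = 2 ∨ j = 3 by omega) with rfl | rfl | rfl | rfl
    · exact (H 1 b g hb (by rwa [p0])).symm
    · exact (H 1 g a hg (by rwa [p0])).trans hba.symm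
    · exact H 2 g b hg (by rwa [p1])
    · exact (H 3 g c hg (by rwa [p2])).trans hcb

/-- An odd cycle and an even cycle that are disjoint. -/
theorem TriConn.win_of_disjoint [Finite V] (hG : G.TriConn) {n m : ℕ} {o : ℤ → V}
    (ho : G.IsCyc n o) (hn : n % 2 = 1) (hm : m % 2 = 0) (hc : G.CycIn (Set.range o)ᶜ m) :
    G.Win := by
  rcases hG.exists_even_complement ho.connOn ⟨o 0, 0, rfl⟩ hm hc with h |
    ⟨K, s, v, hoK, hK, hs, hv, hcov, hvK, hatt⟩
  · exact h
  by_contra hwin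
  -- By `BothPar.ear`, a maximal `L` has no ear inside `K`.
  obtain ⟨L, hoL, hLm⟩ := (Set.toFinite {L : Set V | L ⊆ K ∧ G.BothPar L}).exists_le_maximal
    (a := Set.range o) ⟨hoK, ho.bothPar hn⟩
  obtain ⟨hLK, hL⟩ := hLm.prop
  have hear : ∀ h h' g g', G.Reach (K \ L) h h' → g ∈ L → g' ∈ L → G.Adj h g → G.Adj h' g' →
      g = g' := by
    intro h h' g g' hr hg hg' hhg hhg'
    by_contra hgg
    obtain ⟨l, hl⟩ := hr.exists_pathIn
    obtain ⟨T, hTS, ⟨t, ht⟩, hT⟩ := hL.ear hg hg' hgg hl (fun u hu => hu.2) hhg.symm hhg'.symm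
    have := hLm.le_of_ge (y := L ∪ T) ⟨Set.union_subset hLK (hTS.trans Set.sdiff_subset), hT⟩
      Set.subset_union_left
    exact (hTS ht).2 (this (Or.inr ht))
  have H : ∀ i g g', G.Gate K L (v i) g → G.Gate K L (v (i + s + 1)) g' → g = g' := by
    intro i g g' hg hg'
    by_contra hgg
    obtain ⟨k, k', l, h1, h2, h3, h4⟩ := hg.exists_parity hLK hL hear hg' hgg (s + 1)
    exact hwin (hv.win_of_outside hs hvK h4 h1 h2 (by omega))
  obtain ⟨γ₀, hγ₀, γ₁, hγ₁, hγ⟩ := gate_cases hv H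
    (fun i hi => hK.exists_gate hLK ⟨o 0, hoL ⟨0, rfl⟩⟩ hi) hatt
  -- An odd cycle has at least three vertices, so some `u ∈ L` is not one of the two gates. A walk
  -- from `u` to the even cycle avoiding both gates would produce a third gate.
  obtain ⟨u, hu, hu0, hu1⟩ : ∃ u ∈ L, u ≠ γ₀ ∧ u ≠ γ₁ := by
    by_contra! hcon
    have h3 := ho.three_le
    have key : ∀ i j : ℤ, 0 ≤ i → i < j → j < 3 → o i ≠ o j := fun i j h1 h2 h3 h => by
      have := ho.inj _ _ h (by omega) (by omega); omega
    have k01 := key 0 1 (by omega) (by omega) (by omega)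
    have k02 := key 0 2 (by omega) (by omega) (by omega)
    have k12 := key 1 2 (by omega) (by omega) (by omega)
    have a0 := or_iff_not_imp_left.2 (hcon (o 0) (hoL ⟨_, rfl⟩))
    have a1 := or_iff_not_imp_left.2 (hcon (o 1) (hoL ⟨_, rfl⟩))
    have a2 := or_iff_not_imp_left.2 (hcon (o 2) (hoL ⟨_, rfl⟩))
    clear * - a0 a1 a2 k01 k02 k12
    grind
  obtain ⟨a, b, h1, h2, h3, h4⟩ := (hG.reach γ₀ γ₁ u (v 0) hu0 hu1 (fun h => hvK 0 (h ▸ hLK hγ₀))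
    (fun h => hvK 0 (h ▸ hLK hγ₁))).exit K (hLK hu) (hvK 0)
  obtain ⟨t, rfl⟩ := (hcov b).resolve_left h4
  have key : ∀ g, G.Gate K L (v t) g → g ≠ γ₀ → g ≠ γ₁ → False := fun g hg h h' =>
    (hγ t g hg).elim h h'
  by_cases haL : a ∈ L
  · exact key a ⟨haL, Or.inl h2.symm⟩ h1.right_mem.1.1 h1.right_mem.1.2
  · obtain ⟨a', g, f1, f2, f3, f4⟩ := h1.symm.exit Lᶜ haL (by simpa using hu)
    exact key g ⟨by simpa using f4, Or.inr ⟨a, a', h2.symm, f1.mono (fun w hw => ⟨hw.1.2, hw.2⟩), f2⟩⟩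
      f3.1.1 f3.1.2

/-! ### Shortest odd cycles and their ears -/

/-- Two vertices `y`, `y'` with the same two neighbours, at distance two on an odd cycle, and a path
from `y` to the cycle that avoids `y'`. -/
theorem IsCyc.win_of_twins {n : ℕ} {v : ℤ → V} (hv : G.IsCyc n v) (hn : n % 2 = 1) {y y' : V}
    (hyy : y ≠ y') (hy : y ∉ v '' Set.Icc 2 n) (hy' : y' ∉ v '' Set.Icc 2 n)
    (a0 : G.Adj y (v 0)) (a2 : G.Adj y (v 2)) (b0 : G.Adj y' (v 0)) (b2 : G.Adj y' (v 2)) {j : ℤ}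
    (hj : 3 ≤ j) (hjn : j < n) {T : Set V} {l : ℕ} (hl : G.PathIn T y (v j) l) (hl0 : 0 < l)
    (hT : ∀ u ∈ T, u = y ∨ u = v j ∨ u ≠ y' ∧ u ∉ v '' Set.Icc 2 n) : G.Win := by
  have hvn : v n = v 0 := by have := hv.period 0; rwa [zero_add] at this
  have p1 := hv.arc' (i := 2) (j := j) (by omega) (by omega)
  have p2 := (hv.arc' (i := j) (j := n) (by omega) (by omega)).symm
  rw [hvn] at p2
  have s1 : v '' Set.Icc 2 j ⊆ v '' Set.Icc 2 n := Set.image_mono (Set.Icc_subset_Icc_right hjn.le)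
  have s2 : v '' Set.Icc j n ⊆ v '' Set.Icc 2 n :=
    Set.image_mono (Set.Icc_subset_Icc_left (by omega))
  have h0 : v 0 ∈ v '' Set.Icc 2 n := ⟨n, ⟨by omega, le_rfl⟩, hvn⟩
  have h2 : v 2 ∈ v '' Set.Icc 2 n := ⟨2, ⟨le_rfl, by omega⟩, rfl⟩
  have h01 : v 0 ∉ v '' Set.Icc 2 j := by
    rintro ⟨t, ⟨t1, t2⟩, h⟩
    have := hv.inj _ _ h (by omega) (by omega)
    omega
  have h22 : v 2 ∉ v '' Set.Icc j n := by
    rintro ⟨t, ⟨t1, t2⟩, h⟩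
    have := hv.inj _ _ h (by omega) (by omega)
    omega
  have hy0 : y ≠ v 0 := a0.ne
  have hy2 : y ≠ v 2 := a2.ne
  have hy0' : y' ≠ v 0 := b0.ne
  have hy2' : y' ≠ v 2 := b2.ne
  have q1 := PathIn.cons a2 p1 (fun h => hy (s1 h))
  have q2 := PathIn.cons a0 (PathIn.cons b0.symm (PathIn.cons b2 p1 (fun h => hy' (s1 h)))
    (by simp only [Set.mem_insert_iff, not_or]; exact ⟨hy0'.symm, h01⟩))
    (by simp only [Set.mem_insert_iff, not_or]; exact ⟨hy0, hyy, fun h => hy (s1 h)⟩)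
  have q3 := PathIn.cons a0 p2 (fun h => hy (s2 h))
  have q4 := PathIn.cons a2 (PathIn.cons b2.symm (PathIn.cons b0 p2 (fun h => hy' (s2 h)))
    (by simp only [Set.mem_insert_iff, not_or]; exact ⟨hy2'.symm, h22⟩))
    (by simp only [Set.mem_insert_iff, not_or]; exact ⟨hy2, hyy, fun h => hy (s2 h)⟩)
  have hsub : ∀ R : Set V, R ⊆ insert y (insert y' (v '' Set.Icc 2 n)) → ∀ u, u ∈ T → u ∈ R →
      u = y ∨ u = v j := by
    intro R hR u hu hu'
    rcases hT u hu with h | h | h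
    · exact Or.inl h
    · exact Or.inr h
    · rcases hR hu' with h' | h' | h'
      · exact Or.inl h'
      · exact (h.1 h').elim
      · exact (h.2 h').elim
  have i1 : v '' Set.Icc 2 j ⊆ insert y (insert y' (v '' Set.Icc 2 n)) :=
    fun u hu => Or.inr (Or.inr (s1 hu))
  have i2 : v '' Set.Icc j n ⊆ insert y (insert y' (v '' Set.Icc 2 n)) :=
    fun u hu => Or.inr (Or.inr (s2 hu))
  have iy : y ∈ insert y (insert y' (v '' Set.Icc 2 n)) := Or.inl rfl
  have iy' : y' ∈ insert y (insert y' (v '' Set.Icc 2 n)) := Or.inr (Or.inl rfl)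
  have i0 : v 0 ∈ insert y (insert y' (v '' Set.Icc 2 n)) := Or.inr (Or.inr h0)
  have i22 : v 2 ∈ insert y (insert y' (v '' Set.Icc 2 n)) := Or.inr (Or.inr h2)
  have hne : y ≠ v j := fun h => hy ⟨j, ⟨by omega, hjn.le⟩, h.symm⟩
  -- The 4-cycle through `y` and `y'` reaches `v 2`, or `v 0`, in one or three steps. This gives
  -- route lengths `j - 1, j + 1` and `n - j + 1, n - j + 3`; as `n` is odd, one pair has the parity
  -- of `l`.
  by_cases hpar : ((l : ℤ) + j) % 2 = 1
  · exact hl.win_of_three_le q1 q2 (by omega) (by omega) (by omega) hne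
      (hsub _ (Set.insert_subset iy i1))
      (hsub _ (Set.insert_subset iy (Set.insert_subset i0 (Set.insert_subset iy' i1))))
  · exact hl.win_of_three_le q3 q4 (by omega) (by omega) (by omega) hne
      (hsub _ (Set.insert_subset iy i2))
      (hsub _ (Set.insert_subset iy (Set.insert_subset i22 (Set.insert_subset iy' i2))))

/-- A vertex outside an odd cycle of length at least five that is adjacent to two vertices of the
cycle at distance two. -/
theorem TriConn.win_of_common_nbr (hG : G.TriConn) {n : ℕ} {v : ℤ → V} (hv : G.IsCyc n v)
    (hn : n % 2 = 1) (h5 : 5 ≤ n) {x : V} (hx : x ∉ Set.range v) {i : ℤ} (h0 : G.Adj x (v i))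
    (h2 : G.Adj x (v (i + 2))) : G.Win := by
  wlog hi : i = 0 generalizing i v
  · refine this (hv.shift i) (i := 0) ?_ ?_ ?_ rfl
    · rintro ⟨t, ht⟩; exact hx ⟨_, ht⟩
    · simpa using h0
    · rwa [show (0 : ℤ) + 2 + i = i + 2 by ring]
  subst hi
  rw [zero_add] at h2
  have hvne : ∀ i j : ℤ, i < j → j < i + n → v i ≠ v j := fun i j hi hj h => by
    have := hv.inj _ _ h (by omega) (by omega); omega
  have h1n : v 1 ∉ v '' Set.Icc 2 n := by
    rintro ⟨t, ⟨t1, t2⟩, h⟩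
    exact hvne 1 t (by omega) (by omega) h.symm
  have hxn : x ∉ v '' Set.Icc 2 n := fun h => hx (Set.image_subset_range _ _ h)
  have hx1 : x ≠ v 1 := fun h => hx ⟨1, h.symm⟩
  have c0 : G.Adj (v 1) (v 0) := by have := hv.adj 0; rw [zero_add] at this; exact this.symm
  have c2 : G.Adj (v 1) (v 2) := hv.adj 1
  -- `x` and `v 1` are twins over `v 0` and `v 2`. Deleting these two leaves a path to the rest of
  -- the cycle; followed backwards from there to the first twin met, it avoids the other twin.
  have key : ∃ y, ∃ j : ℤ, (y = x ∨ y = v 1) ∧ 3 ≤ j ∧ j < n ∧ ∃ T l, G.PathIn T y (v j) l ∧ 0 < l ∧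
      ∀ u ∈ T, u = y ∨ u = v j ∨ (u ≠ x ∧ u ≠ v 1) ∧ u ∉ v '' Set.Icc 2 n := by
    obtain ⟨a, b, f1, f2, f3, f4⟩ := (hG.reach (v 0) (v 2) x (v 3) h0.ne h2.ne
      (hvne 0 3 (by omega) (by omega)).symm (hvne 2 3 (by omega) (by omega)).symm).exit
      (v '' Set.Ico 3 n)ᶜ (fun ⟨t, _, h⟩ => hx ⟨t, h⟩)
      (fun h => h ⟨3, ⟨le_rfl, by omega⟩, rfl⟩)
    rw [Set.mem_compl_iff, not_not] at f4
    obtain ⟨j, ⟨j1, j2⟩, rfl⟩ := f4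
    have hSn : ∀ u ∈ {u | u ≠ v 0 ∧ u ≠ v 2} ∩ (v '' Set.Ico 3 n)ᶜ, u ∉ v '' Set.Icc 2 n := by
      rintro u ⟨hu1, hu2⟩ ⟨t, ⟨t1, t2⟩, rfl⟩
      by_cases ht : t = n
      · subst ht
        have := hv.period 0
        rw [zero_add] at this
        exact hu1.1 this
      · by_cases ht2 : t = 2
        · exact hu1.2 (ht2 ▸ rfl)
        · exact hu2 ⟨t, ⟨by omega, by omega⟩, rfl⟩
    by_cases ha : a = x ∨ a = v 1
    · refine ⟨a, j, ha, j1, j2, {a, v j}, 0 + 1, ?_, by omega, ?_⟩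
      · exact PathIn.cons f2 (PathIn.single (Set.mem_singleton _)) (by simpa using f2.ne)
      · rintro u (h | h)
        · exact Or.inl h
        · exact Or.inr (Or.inl h)
    · obtain ⟨a', y, g1, g2, g3, g4⟩ := f1.symm.exit {u | ¬ (u = x ∨ u = v 1)} ha
        (fun h => h (Or.inl rfl))
      simp only [Set.mem_ofPred_eq, not_not] at g4
      obtain ⟨l, hl⟩ := g1.symm.exists_pathIn
      have hvj : v j ∈ v '' Set.Icc 2 n := ⟨j, ⟨by omega, by omega⟩, rfl⟩
      have hlj := hl.snoc f2 (fun h => hSn _ h.1 hvj)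
      refine ⟨y, j, g4, j1, j2, _, _, hlj.cons g2.symm ?_, by omega, ?_⟩
      · rintro (h | h)
        · rcases g4 with h' | h'
          · exact hx ⟨j, (h'.symm.trans h).symm⟩
          · exact h1n (h' ▸ h ▸ hvj)
        · exact h.2 g4
      · rintro u (h | h | h)
        · exact Or.inl h
        · exact Or.inr (Or.inl h)
        · exact Or.inr (Or.inr ⟨not_or.1 h.2, hSn u h.1⟩)
  obtain ⟨y, j, hy, j1, j2, T, l, hl, hl0, hT⟩ := key
  rcases hy with rfl | rfl
  · exact hv.win_of_twins hn hx1 hxn h1n h0 h2 c0 c2 j1 j2 hl hl0 (fun u hu => by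
      have := hT u hu; tauto)
  · exact hv.win_of_twins hn hx1.symm h1n hxn c0 c2 h0 h2 j1 j2 hl hl0 (fun u hu => by
      have := hT u hu; tauto)

/-- An ear of a shortest odd cycle. -/
theorem IsCyc.le_of_ear {n : ℕ} {v : ℤ → V} (hv : G.IsCyc n v) (hn : n % 2 = 1)
    (hmin : ∀ m, m % 2 = 1 → G.CycIn Set.univ m → n ≤ m) {i j : ℤ} (hij : i < j) (hj : j < i + n)
    {S : Set V} {m : ℕ} (hp : G.PathIn S (v i) (v j) m)
    (hd : ∀ u ∈ S, u ∈ Set.range v → u = v i ∨ u = v j) :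
    ((m + (j - i)) % 2 = 1 → m + (j - i) ≤ 1 ∨ n ≤ m + (j - i)) ∧
      ((m + (j - i)) % 2 = 0 → m + n - (j - i) ≤ 1 ∨ j - i ≤ m) := by
  constructor
  · intro h
    by_cases h1 : m + (j - i) ≤ 1
    · exact Or.inl h1
    · have := hmin _ (by omega) ((hp.close (hv.arc_range hij.le hj) hd (by omega)
        (by omega)).mono (Set.subset_univ _))
      omega
  · intro h
    by_cases h1 : m + n - (j - i) ≤ 1
    · exact Or.inl h1
    · have := hmin _ (by omega) ((hp.close (hv.arc_range' hij hj.le) hd (by omega)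
        (by omega)).mono (Set.subset_univ _))
      omega

theorem IsCyc.exists_lt_rep {n : ℕ} {v : ℤ → V} (hv : G.IsCyc n v) {i j : ℤ} (h : v i ≠ v j) :
    ∃ k, i < k ∧ k < i + n ∧ v k = v j := by
  obtain ⟨k, h1, h2, h3⟩ := hv.exists_rep i j
  refine ⟨k, lt_of_le_of_ne h1 ?_, h2, h3⟩
  rintro rfl
  exact h h3

theorem PathIn.of_two {a b c : V} (hab : G.Adj a b) (hbc : G.Adj b c) (hac : a ≠ c) :
    G.PathIn {a, b, c} a c 2 :=
  PathIn.cons hab (PathIn.cons hbc (PathIn.single (Set.mem_singleton c)) (by simpa using hbc.ne))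
    (by simp [hab.ne, hac])

theorem PathIn.of_one {a b : V} (hab : G.Adj a b) : G.PathIn {a, b} a b 1 :=
  PathIn.cons hab (PathIn.single (Set.mem_singleton b)) (by simpa using hab.ne)

/-- A vertex outside a shortest odd cycle of length at least five has at most one neighbour on it. -/
theorem TriConn.eq_of_shortest (hG : G.TriConn) (hwin : ¬ G.Win) {n : ℕ} {v : ℤ → V}
    (hv : G.IsCyc n v) (hn : n % 2 = 1) (hmin : ∀ m, m % 2 = 1 → G.CycIn Set.univ m → n ≤ m)
    (h5 : 5 ≤ n) {x : V} (hx : x ∉ Set.range v) {i j : ℤ} (hi : G.Adj x (v i))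
    (hj : G.Adj x (v j)) : v i = v j := by
  by_contra hne
  obtain ⟨k, k1, k2, k3⟩ := hv.exists_lt_rep hne
  rw [← k3] at hj hne
  have := hv.le_of_ear hn hmin k1 k2 (PathIn.of_two hi.symm hj hne) (by
    rintro u (h | h | h) hu
    · exact Or.inl h
    · exact (hx (h ▸ hu)).elim
    · exact Or.inr h)
  -- An ear of length two on a shortest odd cycle can only replace an arc of length two.
  have h2 : k = i + 2 ∨ k = i + n - 2 := by omega
  rcases h2 with rfl | rfl
  · exact hwin (hG.win_of_common_nbr hv hn h5 hx hi hj)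
  · refine hwin (hG.win_of_common_nbr hv hn h5 hx hj ?_)
    rwa [show i + n - 2 + 2 = i + n by ring, hv.period]

/-- Outside a shortest odd cycle of length at least five there is another cycle. -/
theorem TriConn.exists_cycIn_compl [Finite V] (hG : G.TriConn) (hwin : ¬ G.Win) {n : ℕ} {v : ℤ → V}
    (hv : G.IsCyc n v) (hn : n % 2 = 1) (hmin : ∀ m, m % 2 = 1 → G.CycIn Set.univ m → n ≤ m)
    (h5 : 5 ≤ n) : ∃ k, G.CycIn (Set.range v)ᶜ k := by
  apply exists_cycIn
  -- A shortest odd cycle has no chord, so a third neighbour of `v 0` lies off it.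
  · obtain ⟨u, h1, h2, h3⟩ := hG.exists_adj (v 0) (v 1) (v (-1))
    refine ⟨u, ?_⟩
    rintro ⟨j, rfl⟩
    obtain ⟨k, k1, k2, k3⟩ := hv.exists_lt_rep h1.ne
    rw [← k3] at h1 h2 h3
    have := hv.le_of_ear hn hmin k1 k2 (PathIn.of_one h1) (by
      rintro u (h | h) hu
      · exact Or.inl h
      · exact Or.inr h)
    have h2' : k = 1 ∨ k = -1 + n := by omega
    rcases h2' with rfl | rfl
    · exact h2 rfl
    · exact h3 (hv.period _)
  · intro x hx a
    by_cases h : ∃ i, G.Adj x (v i)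
    · obtain ⟨i, hi⟩ := h
      obtain ⟨u, h1, h2, h3⟩ := hG.exists_adj x (v i) a
      refine ⟨u, ?_, h1, h3⟩
      rintro ⟨j, rfl⟩
      exact h2 (hG.eq_of_shortest hwin hv hn hmin h5 hx h1 hi)
    · obtain ⟨u, h1, h2, h3⟩ := hG.exists_adj x a a
      refine ⟨u, ?_, h1, h3⟩
      rintro ⟨j, rfl⟩
      exact h ⟨j, h1⟩

/-! ### A triangle with acyclic complement -/

theorem IsCyc.triangle_fill {v : ℤ → V} (hv : G.IsCyc 3 v) {i j : ℤ} (hne : v i ≠ v j) :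
    G.Adj (v i) (v j) ∧ ∃ w ∈ Set.range v, w ≠ v i ∧ w ≠ v j ∧ G.Adj (v i) w ∧ G.Adj w (v j) := by
  obtain ⟨k, k1, k2, k3⟩ := hv.exists_lt_rep hne
  rw [← k3]
  have a1 := hv.adj i
  have a2 := hv.adj (i + 1)
  have a3 := hv.adj (i + 2)
  rw [show i + 2 + 1 = i + (3 : ℕ) by push_cast; ring, hv.period] at a3
  rw [show i + 1 + 1 = i + 2 by ring] at a2
  rcases (show k = i + 1 ∨ k = i + 2 by omega) with rfl | rfl
  · exact ⟨a1, v (i + 2), ⟨_, rfl⟩, a3.ne, a2.ne', a3.symm, a2.symm⟩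
  · exact ⟨a3.symm, v (i + 1), ⟨_, rfl⟩, a1.ne', a2.ne, a1, a2⟩

theorem IsCyc.triangle_cover {v : ℤ → V} (hv : G.IsCyc 3 v) {a b c : ℤ} (hab : v a ≠ v b)
    (hac : v a ≠ v c) (hbc : v b ≠ v c) (e : ℤ) : v e = v a ∨ v e = v b ∨ v e = v c := by
  obtain ⟨a', a1, a2, a3⟩ := hv.exists_rep 0 a
  obtain ⟨b', b1, b2, b3⟩ := hv.exists_rep 0 b
  obtain ⟨c', c1, c2, c3⟩ := hv.exists_rep 0 c
  obtain ⟨e', e1, e2, e3⟩ := hv.exists_rep 0 e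
  rw [← a3, ← b3] at hab
  rw [← a3, ← c3] at hac
  rw [← b3, ← c3] at hbc
  rw [← a3, ← b3, ← c3, ← e3]
  have h1 : a' ≠ b' := fun h => hab (h ▸ rfl)
  have h2 : a' ≠ c' := fun h => hac (h ▸ rfl)
  have h3 : b' ≠ c' := fun h => hbc (h ▸ rfl)
  rcases (show e' = a' ∨ e' = b' ∨ e' = c' by omega) with rfl | rfl | rfl
  · exact Or.inl rfl
  · exact Or.inr (Or.inl rfl)
  · exact Or.inr (Or.inr rfl)

/-- The vertex `z` has two neighbours on the cycle `v`. -/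
def TwoAtt (G : SimpleGraph V) (v : ℤ → V) (z : V) : Prop :=
  ∃ i j, v i ≠ v j ∧ G.Adj (v i) z ∧ G.Adj (v j) z

/-- Two vertices of a triangle are joined by paths of lengths 1 and 2; either closes the outside
path. -/
theorem IsCyc.triangle_cyc {v : ℤ → V} (hv : G.IsCyc 3 v) {S : Set V} {x y : V} {p : ℕ}
    (h : G.PathIn S x y p) (hS : ∀ u ∈ S, u ∉ Set.range v) {i j : ℤ} (hne : v i ≠ v j)
    (hi : G.Adj (v i) x) (hj : G.Adj (v j) y) :
    G.CycIn Set.univ (p + 3) ∧ G.CycIn Set.univ (p + 4) := by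
  obtain ⟨h1, w, hw, hwi, hwj, h2, h3⟩ := hv.triangle_fill hne
  have hp := h.ends hi hj hne (fun h => hS _ h ⟨_, rfl⟩) (fun h => hS _ h ⟨_, rfl⟩)
  refine ⟨(hp.closeAdj h1 (by omega)).mono (Set.subset_univ _),
    (hp.close (PathIn.of_two h2 h3 hne) ?_ (by omega) (by omega)).mono (Set.subset_univ _)⟩
  rintro u hu (hu' | hu' | hu')
  · exact Or.inl hu'
  · subst hu'
    rcases hu with hu | hu | hu
    · exact (hwi hu).elim
    · exact (hwj hu).elim
    · exact (hS _ hu hw).elim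
  · exact Or.inr hu'

theorem IsCyc.triangle_cyc_twoAtt {v : ℤ → V} (hv : G.IsCyc 3 v) {S : Set V} {x y : V} {p : ℕ}
    (h : G.PathIn S x y p) (hS : ∀ u ∈ S, u ∉ Set.range v) (hx : G.TwoAtt v x) {j : ℤ}
    (hj : G.Adj (v j) y) : G.CycIn Set.univ (p + 3) ∧ G.CycIn Set.univ (p + 4) := by
  obtain ⟨a, b, hab, ha, hb⟩ := hx
  by_cases h1 : v a = v j
  · exact hv.triangle_cyc h hS (fun h2 => hab (h1.trans h2.symm)) hb hj
  · exact hv.triangle_cyc h hS h1 ha hj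

/-- In a set without cycles, a path may start with any edge leaving it. -/
theorem PathIn.extend {U : Set V} (hac : ∀ k, ¬ G.CycIn U k) {x y z w : V} {n : ℕ} (hx : x ∈ U)
    (hxw : G.Adj x w) (h : G.PathIn (U \ {x}) w y n) (hz : z ∈ U) (hxz : G.Adj x z)
    (hne : z ≠ w) : G.PathIn (U \ {z}) x y (n + 1) := by
  obtain ⟨q, h0, hn, ha, hi, hS⟩ := h
  subst h0 hn
  by_cases hj : ∃ j ≤ n, q j = z
  · obtain ⟨j, hj, rfl⟩ := hj
    have hj0 : j ≠ 0 := by rintro rfl; exact hne rfl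
    have hp : G.PathIn (U \ {x}) (q 0) (q j) j := ⟨q, rfl, rfl, fun i h => ha i (by omega),
      fun i h k h' => hi i (by omega) k (by omega), fun i h => hS i (by omega)⟩
    refine (hac _ (((hp.cons hxw (by simp)).closeAdj hxz (by omega)).mono ?_)).elim
    exact Set.insert_subset hx Set.sdiff_subset
  · push Not at hj
    have hp : G.PathIn ((U \ {x}) \ {z}) (q 0) (q n) n := ⟨q, rfl, rfl, ha, hi, fun i h =>
      ⟨hS i h, hj i h⟩⟩
    refine (hp.cons hxw (by simp)).mono (Set.insert_subset ⟨hx, hxz.ne⟩ ?_)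
    exact Set.sdiff_subset_sdiff_left Set.sdiff_subset

theorem TriConn.twoAtt_of_leaf (hG : G.TriConn) {v : ℤ → V} {x w : V} (h : ∀ z, z ∉ Set.range v → G.Adj x z → z = w) :
    G.TwoAtt v x := by
  obtain ⟨u, h1, h2, -⟩ := hG.exists_adj x w w
  obtain ⟨i, rfl⟩ : u ∈ Set.range v := by_contra fun hu => h2 (h u hu h1)
  obtain ⟨u', h1', h2', h3'⟩ := hG.exists_adj x w (v i)
  obtain ⟨j, rfl⟩ : u' ∈ Set.range v := by_contra fun hu => h2' (h u' hu h1')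
  exact ⟨i, j, h3'.symm, h1.symm, h1'.symm⟩

section Triangle

variable (hG : G.TriConn) {v : ℤ → V} (hv : G.IsCyc 3 v)
include hG hv

theorem TriConn.exists_outside (s : Finset V) (hs : s.card ≤ 2) : ∃ u ∉ Set.range v, u ∉ s := by
  classical
  obtain ⟨u, hu⟩ := hG.many (s ∪ {v 0, v 1, v 2}) (by
    have := Finset.card_union_le s {v 0, v 1, v 2}
    have := Finset.card_le_three (a := v 0) (b := v 1) (c := v 2)
    omega)
  simp only [Finset.mem_union, Finset.mem_insert, Finset.mem_singleton, not_or] at hu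
  refine ⟨u, ?_, hu.1⟩
  rintro ⟨i, rfl⟩
  obtain ⟨j, j1, j2, j3⟩ := hv.exists_rep 0 i
  rw [← j3] at hu
  rcases (show j = 0 ∨ j = 1 ∨ j = 2 by omega) with rfl | rfl | rfl
  · exact hu.2.1 rfl
  · exact hu.2.2.1 rfl
  · exact hu.2.2.2 rfl

/-- By degree three each outside vertex sees the whole triangle. There are at least three of them,
and `K_{3,3}` has cycles of lengths 4 and 6. -/
theorem TriConn.win_of_triangle_indep (h : ∀ x y, x ∉ Set.range v → y ∉ Set.range v → ¬ G.Adj x y) :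
    G.Win := by
  classical
  have hadj : ∀ x, x ∉ Set.range v → ∀ i, G.Adj x (v i) := by
    intro x hx i
    obtain ⟨u, h1, h2, h3⟩ := hG.exists_adj x (v (i + 1)) (v (i + 2))
    obtain ⟨j, rfl⟩ : u ∈ Set.range v := by_contra fun hu => h x u hx hu h1
    obtain ⟨k, k1, k2, k3⟩ := hv.exists_rep i j
    rw [← k3] at h1 h2 h3
    rcases (show k = i ∨ k = i + 1 ∨ k = i + 2 by omega) with rfl | rfl | rfl
    · exact h1
    · exact (h2 rfl).elim
    · exact (h3 rfl).elim
  obtain ⟨x, hx, -⟩ := hG.exists_outside hv ∅ (by simp)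
  obtain ⟨y, hy, hxy⟩ := hG.exists_outside hv {x} (by simp)
  obtain ⟨z, hz, hxz⟩ := hG.exists_outside hv {x, y} Finset.card_le_two
  simp only [Finset.mem_insert, Finset.mem_singleton, not_or] at hxy hxz
  have e01 : v 0 ≠ v 1 := fun h => by have := hv.inj _ _ h (by omega) (by omega); omega
  have e02 : v 0 ≠ v 2 := fun h => by have := hv.inj _ _ h (by omega) (by omega); omega
  have e12 : v 1 ≠ v 2 := fun h => by have := hv.inj _ _ h (by omega) (by omega); omega
  have hne : ∀ u, u ∉ Set.range v → ∀ i, u ≠ v i := fun u hu i h => hu ⟨i, h.symm⟩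
  have c6 := ((PathIn.of_two (hadj x hx 0).symm (hadj x hx 1) e01).join (hadj y hy 1).symm
    (PathIn.of_two (hadj y hy 2) (hadj z hz 2).symm (Ne.symm hxz.2)) (by
      rintro u (rfl | rfl | rfl) (h' | h' | h')
      · exact hne y hy _ h'.symm
      · exact e02 h'
      · exact hne z hz _ h'.symm
      · exact hxy h'.symm
      · exact hne _ hx _ h'
      · exact hxz.1 h'.symm
      · exact hne y hy _ h'.symm
      · exact e12 h'
      · exact hne z hz _ h'.symm)).closeAdj (hadj z hz 0).symm (by omega)
  have c4 := (PathIn.of_two (hadj x hx 0) (hadj y hy 0).symm (Ne.symm hxy)).close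
    (PathIn.of_two (hadj x hx 1) (hadj y hy 1).symm (Ne.symm hxy)) (by
      rintro u (h' | rfl | h') (h'' | h'' | h'')
      · exact Or.inl h'
      · exact Or.inl h'
      · exact Or.inl h'
      · exact Or.inl h''
      · exact (e01 h'').elim
      · exact Or.inr h''
      · exact Or.inr h'
      · exact Or.inr h'
      · exact Or.inr h') (by omega) (by omega)
  exact win_of_cyc c4 c6 rfl rfl

/-- Each outside vertex has at most one outside neighbour, hence two on the triangle, and the edge
`ab` gives a 4-cycle. The two triangle neighbours of a further vertex `w` do not separate `ab` from
`w`, so an end `k` of `ab` sees the third corner `v c`. With `k'` the other end, `v c, k, k', v e,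
w, v e'` is a 6-cycle. -/
theorem TriConn.win_of_triangle_matching {a b : V} (ha : a ∉ Set.range v) (hb : b ∉ Set.range v)
    (hab : G.Adj a b) (h2 : ∀ x y z, x ∉ Set.range v → y ∉ Set.range v → z ∉ Set.range v →
      G.Adj x y → G.Adj y z → x = z) : G.Win := by
  classical
  have htwo : ∀ u, u ∉ Set.range v → G.TwoAtt v u := by
    intro u hu
    by_cases h : ∃ w, w ∉ Set.range v ∧ G.Adj u w
    · obtain ⟨w, hw, huw⟩ := h
      exact hG.twoAtt_of_leaf (w := w) fun z hz huz => h2 z u w hz hu hw huz.symm huw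
    · push Not at h
      exact hG.twoAtt_of_leaf (w := u) fun z hz huz => (h z hz huz).elim
  obtain ⟨w, hw, hwab⟩ := hG.exists_outside hv {a, b} Finset.card_le_two
  simp only [Finset.mem_insert, Finset.mem_singleton, not_or] at hwab
  have hne : ∀ u, u ∉ Set.range v → ∀ i, u ≠ v i := fun u hu i h => hu ⟨i, h.symm⟩
  obtain ⟨i, j, hij, hi, hj⟩ := htwo w hw
  have c4 : G.CycIn Set.univ 4 := by
    obtain ⟨j', -, -, hj', -⟩ := htwo b hb
    exact (hv.triangle_cyc_twoAtt (PathIn.of_one hab) (by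
      rintro u (rfl | rfl) <;> assumption) (htwo a ha) hj').1
  obtain ⟨k, hk, u, hu, hku, h3, h4, -, -⟩ := hG.exists_cross {a, b} (a := v i) (b := v j)
    (x := a) (y := w) (Or.inl rfl) (by simpa using hwab) (hne a ha i) (hne a ha j) (hne w hw i)
    (hne w hw j)
  obtain ⟨k', hkk, hk', hkr, hkr', hwk, hwk', huk⟩ : ∃ k', G.Adj k k' ∧ (k' = a ∨ k' = b) ∧
      k ∉ Set.range v ∧ k' ∉ Set.range v ∧ w ≠ k ∧ w ≠ k' ∧ u ≠ k' := by
    rcases hk with rfl | rfl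
    · exact ⟨b, hab, Or.inr rfl, ha, hb, hwab.1, hwab.2, fun h => hu (Or.inr h)⟩
    · exact ⟨a, hab.symm, Or.inl rfl, hb, ha, hwab.2, hwab.1, fun h => hu (Or.inl h)⟩
  obtain ⟨c, rfl⟩ : u ∈ Set.range v := by_contra fun hu' =>
    huk (h2 u k k' hu' hkr hkr' hku.symm hkk)
  obtain ⟨e, hce, hek⟩ : ∃ e, v e ≠ v c ∧ G.Adj (v e) k' := by
    obtain ⟨p, q, hpq, hp, hq⟩ := htwo k' hkr'
    by_cases hpc : v p = v c
    · exact ⟨q, fun h => hpq (hpc.trans h.symm), hq⟩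
    · exact ⟨p, hpc, hp⟩
  obtain ⟨e', hee, hec, hew, hew'⟩ : ∃ e', v e ≠ v e' ∧ v e' ≠ v c ∧ G.Adj (v e) w ∧
      G.Adj (v e') w := by
    rcases hv.triangle_cover hij h3.symm h4.symm e with h | h | h
    · exact ⟨j, h ▸ hij, h4.symm, h ▸ hi, hj⟩
    · exact ⟨i, h ▸ hij.symm, h3.symm, h ▸ hj, hi⟩
    · exact (hce h).elim
  have c6 := ((PathIn.of_two hku.symm hkk (hne k' hkr' c).symm).join hek.symm
    (PathIn.of_two hew hew'.symm hee) (by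
      rintro u (rfl | rfl | rfl) (h' | h' | h')
      · exact hce h'.symm
      · exact hne w hw _ h'.symm
      · exact hec h'.symm
      · exact hne _ hkr _ h'
      · exact hwk h'.symm
      · exact hne _ hkr _ h'
      · exact hne _ hkr' _ h'
      · exact hwk' h'.symm
      · exact hne _ hkr' _ h')).closeAdj (hv.triangle_fill hec.symm).1 (by omega)
  exact win_of_cyc c4 c6 rfl rfl

/-- A triangle whose complement is acyclic. -/
theorem TriConn.win_of_triangle_acyclic [Finite V] (hac : ∀ k, ¬ G.CycIn (Set.range v)ᶜ k) :
    G.Win := by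
  obtain ⟨x₀, hx₀, -⟩ := hG.exists_outside hv ∅ (by simp)
  obtain ⟨n, z₀, y, hp, hmax⟩ := exists_longest_path (G := G) (U := (Set.range v)ᶜ) ⟨x₀, hx₀⟩
  rcases n with _ | _ | n
  · refine hG.win_of_triangle_indep hv fun x y hx hy hxy => ?_
    have := hmax _ _ _ ((PathIn.of_one hxy).mono (by rintro u (rfl | rfl) <;> assumption))
    omega
  · obtain ⟨z₁, h1, h2⟩ := hp.uncons
    refine hG.win_of_triangle_matching hv hp.left_mem h2.left_mem.1 h1 fun x y z hx hy hz hxy hyz => ?_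
    by_contra hxz
    have := hmax _ _ _ ((PathIn.of_two hxy hyz hxz).mono (by rintro u (rfl | rfl | rfl) <;> assumption))
    omega
  -- Here `x` starts a path of the maximal length `n + 2`; in an acyclic set any second outside
  -- neighbour would prolong it.
  have leaf : ∀ x w m, x ∉ Set.range v → G.Adj x w → G.PathIn ((Set.range v)ᶜ \ {x}) w y m →
      m = n + 1 → G.TwoAtt v x := by
    rintro x w m hx hxw hpw rfl
    refine hG.twoAtt_of_leaf (w := w) fun z hz hxz => ?_
    by_contra hzw
    have := hmax _ _ _ (((PathIn.extend hac hx hxw hpw hz hxz hzw).cons hxz.symm (by simp)).mono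
      (Set.insert_subset hz Set.sdiff_subset))
    omega
  obtain ⟨z₁, h01, hp1⟩ := hp.uncons
  obtain ⟨z₂, h12, hp2⟩ := hp1.uncons
  have u0 := hp.left_mem
  have u1 := hp1.left_mem
  have u2 := hp2.left_mem
  have n02 : z₀ ≠ z₂ := fun h => u2.1.2 h.symm
  have two0 := leaf z₀ z₁ _ u0 h01 hp1 rfl
  have p02 := PathIn.of_two h01 h12 n02
  have p02U : ∀ u ∈ ({z₀, z₁, z₂} : Set V), u ∉ Set.range v := by
    rintro u (rfl | rfl | rfl)
    exacts [u0, u1.1, u2.1.1]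
  have c4 : G.CycIn Set.univ 4 := by
    obtain ⟨j, -, -, hj, -⟩ := id two0
    exact (hv.triangle_cyc_twoAtt (PathIn.single (Set.mem_singleton z₀))
      (by rintro u rfl; exact u0) two0 hj).2
  -- A 6-cycle arises from an outside path of length 2 or 3 between a vertex with two triangle
  -- neighbours and a vertex with at least one.
  have c6 : G.CycIn Set.univ 6 := by
    by_cases ha2 : ∃ j, G.Adj (v j) z₂
    · obtain ⟨j, hj⟩ := ha2
      exact (hv.triangle_cyc_twoAtt p02 p02U two0 hj).2
    cases n with
    | zero =>
      obtain rfl := hp2.eq_of_zero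
      -- `z₂` is the other end of a longest path, hence a leaf, hence attached to the triangle.
      refine (ha2 ?_).elim
      obtain ⟨j, -, -, hj, -⟩ := hG.twoAtt_of_leaf (x := z₂) (w := z₁) fun z hz hxz => by
        by_contra hzw
        have hzz : z ≠ z₀ := by
          rintro rfl
          exact hac _ ((p02.closeAdj hxz.symm le_rfl).mono p02U)
        have := hmax _ _ _ ((p02.snoc hxz (by simp [hzz, hzw, hxz.ne'])).mono
          (Set.insert_subset hz p02U))
        omega
      exact ⟨j, hj⟩
    | succ n =>
      obtain ⟨z₃, h23, hp3⟩ := hp2.uncons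
      have hp3' : G.PathIn ((Set.range v)ᶜ \ {z₂}) z₃ y n :=
        hp3.mono fun u hu => ⟨hu.1.1.1, hu.2⟩
      obtain ⟨t, ht, ht1, ht3⟩ := hG.exists_adj z₂ z₁ z₃
      have htU : t ∉ Set.range v := by rintro ⟨j, rfl⟩; exact ha2 ⟨j, ht.symm⟩
      have ht0 : t ≠ z₀ := by
        rintro rfl
        exact hac _ ((p02.closeAdj ht.symm le_rfl).mono p02U)
      have hpt := PathIn.extend hac u2.1.1 h23 hp3' htU ht ht3
      by_cases hat : ∃ j, G.Adj (v j) t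
      · obtain ⟨j, hj⟩ := hat
        exact (hv.triangle_cyc_twoAtt (p02.snoc ht (by simp [ht0, ht1, ht.ne']))
          (by rintro u (rfl | h); exacts [htU, p02U u h]) two0 hj).1
      -- Now `t` has two further outside neighbours. Each starts a longest path to `y`, so both are
      -- leaves, and they are joined through `t` by a path of length 2.
      · obtain ⟨s, hs, hs2, -⟩ := hG.exists_adj t z₂ z₂
        obtain ⟨s', hs', hs2', hss⟩ := hG.exists_adj t z₂ s
        have hsU : s ∉ Set.range v := by rintro ⟨j, rfl⟩; exact hat ⟨j, hs.symm⟩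
        have hsU' : s' ∉ Set.range v := by rintro ⟨j, rfl⟩; exact hat ⟨j, hs'.symm⟩
        have two := leaf s t _ hsU hs.symm (PathIn.extend hac htU ht.symm hpt hsU hs hs2) rfl
        have two' := leaf s' t _ hsU' hs'.symm (PathIn.extend hac htU ht.symm hpt hsU' hs' hs2') rfl
        obtain ⟨j, -, -, hj, -⟩ := two'
        exact (hv.triangle_cyc_twoAtt (PathIn.of_two hs.symm hs' hss.symm)
          (by rintro u (rfl | rfl | rfl) <;> assumption) two hj).2
  exact win_of_cyc c4 c6 rfl rfl

end Triangle

/-! ### Two disjoint odd cycles -/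

theorem BothPar.exists_even_cycle {L W : Set V} (hL : G.BothPar L) (hW : G.ConnOn W)
    (hd : ∀ u ∈ W, u ∉ L) {g g' x y : V} (hgg : g ≠ g') (hg : g ∈ L) (hg' : g' ∈ L) (hx : x ∈ W)
    (hy : y ∈ W) (hgx : G.Adj g x) (hgy : G.Adj g' y) : ∃ m, m % 2 = 0 ∧ G.CycIn (L ∪ W) m := by
  obtain ⟨m, hm⟩ := hW.exists_pathIn hx hy
  have hp := hm.ends hgx hgy hgg (fun h => hd _ h hg) (fun h => hd _ h hg')
  obtain ⟨l, hl, hpl⟩ := hL g hg g' hg' hgg m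
  have := hpl.pos_of_ne hgg
  refine ⟨m + 2 + l, by omega, (hp.close hpl ?_ this (by omega)).mono ?_⟩
  · rintro u (h | h | h) hu
    · exact Or.inl h
    · exact Or.inr h
    · exact (hd u h hu).elim
  · exact Set.union_subset (Set.insert_subset (Or.inl hg) (Set.insert_subset (Or.inl hg')
      Set.subset_union_right)) Set.subset_union_left

/-- An odd cycle that spans no even cycle has no chords. -/
theorem IsCyc.chordless {n : ℕ} {v : ℤ → V} (hv : G.IsCyc n v) (hn : n % 2 = 1)
    (hev : ∀ m, m % 2 = 0 → ¬ G.CycIn (Set.range v) m) {i j : ℤ} (hij : G.Adj (v i) (v j)) :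
    v j = v (i + 1) ∨ v j = v (i - 1) := by
  obtain ⟨k, k1, k2, k3⟩ := hv.exists_lt_rep hij.ne
  rw [← k3] at hij ⊢
  by_cases h1 : k = i + 1
  · exact Or.inl (h1 ▸ rfl)
  by_cases h2 : k = i - 1 + n
  · exact Or.inr (h2 ▸ hv.period _)
  exfalso
  by_cases hpar : (k - i) % 2 = 1
  · exact hev _ (by omega) ((hv.arc_range k1.le k2).closeAdj hij (by omega))
  · exact hev _ (by omega) ((hv.arc_range' k1 k2.le).closeAdj hij (by omega))

theorem IsCyc.cross_cycle {n k : ℕ} {v w : ℤ → V} (hvw : ∀ i j, v i ≠ w j) {S T : Set V}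
    (hS : S ⊆ Set.range v) (hT : T ⊆ Set.range w) {a b c d : V} (hp : G.PathIn S a b n)
    (hq : G.PathIn T c d k) (hac : G.Adj a c) (hbd : G.Adj b d) (h1 : 1 ≤ n + k) :
    G.CycIn Set.univ (n + k + 2) := by
  have := (hp.join hbd hq.symm (fun u h1 h2 => by
    obtain ⟨i, rfl⟩ := hS h1
    obtain ⟨j, hj⟩ := hT h2
    exact hvw i j hj.symm)).closeAdj hac (by omega)
  rw [show n + 1 + k + 1 = n + k + 2 by omega] at this
  exact this.mono (Set.subset_univ _)

/-- Two disjoint odd cycles such that no even cycle is disjoint from an odd one of the two. -/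
structure OddPair (G : SimpleGraph V) (n k : ℕ) (v w : ℤ → V) : Prop where
  cyc : G.IsCyc n v
  cyc' : G.IsCyc k w
  odd : n % 2 = 1
  odd' : k % 2 = 1
  ne : ∀ i j, v i ≠ w j
  no_even : ∀ m, m % 2 = 0 → ¬ G.CycIn (Set.range v)ᶜ m
  no_even' : ∀ m, m % 2 = 0 → ¬ G.CycIn (Set.range w)ᶜ m

namespace OddPair

variable {n k : ℕ} {v w : ℤ → V}

theorem symm (h : G.OddPair n k v w) : G.OddPair k n w v :=
  ⟨h.cyc', h.cyc, h.odd', h.odd, fun i j => (h.ne j i).symm, h.no_even', h.no_even⟩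

theorem neg (h : G.OddPair n k v w) : G.OddPair n k (fun i => v (-i)) w :=
  ⟨h.cyc.neg, h.cyc', h.odd, h.odd', fun _ _ => h.ne _ _, by
    rw [show Set.range (fun i => v (-i)) = Set.range v from (Equiv.neg ℤ).surjective.range_comp v]
    exact h.no_even, h.no_even'⟩

theorem shift (h : G.OddPair n k v w) (a b : ℤ) :
    G.OddPair n k (fun i => v (i + a)) (fun i => w (i + b)) :=
  ⟨h.cyc.shift a, h.cyc'.shift b, h.odd, h.odd', fun _ _ => h.ne _ _, by
    rw [show Set.range (fun i => v (i + a)) = Set.range v from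
      (Equiv.addRight a).surjective.range_comp v]
    exact h.no_even, by
    rw [show Set.range (fun i => w (i + b)) = Set.range w from
      (Equiv.addRight b).surjective.range_comp w]
    exact h.no_even'⟩

/-- Two feet of `W` on `v` would give an even cycle in `v ∪ W`, disjoint from `w`. -/
theorem att_unique (h : G.OddPair n k v w) {W : Set V} (hW : G.ConnOn W)
    (hd : ∀ u ∈ W, u ∉ Set.range v) (hd' : ∀ u ∈ W, u ∉ Set.range w) :
    ∃ a, ∀ x ∈ W, ∀ i, G.Adj x (v i) → v i = v a := by
  by_cases hex : ∃ x ∈ W, ∃ i, G.Adj x (v i)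
  · obtain ⟨x, hx, i, hi⟩ := hex
    refine ⟨i, fun y hy j hj => ?_⟩
    by_contra hne
    obtain ⟨m, hm, hc⟩ := (h.cyc.bothPar h.odd).exists_even_cycle hW hd hne ⟨_, rfl⟩ ⟨_, rfl⟩ hy hx
      hj.symm hi.symm
    refine h.no_even' m hm (hc.mono ?_)
    rintro u (⟨t, rfl⟩ | hu) ⟨s, hs⟩
    · exact h.ne t s hs.symm
    · exact hd' u hu ⟨s, hs⟩
  · exact ⟨0, fun x hx i hi => (hex ⟨x, hx, i, hi⟩).elim⟩

/-- A component off both cycles has at most one foot on each, and two vertices cannot separate it.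
-/
theorem cover (h : G.OddPair n k v w) (hG : G.TriConn) (u : V) :
    u ∈ Set.range v ∨ u ∈ Set.range w := by
  by_contra! hu
  set U : Set V := {u | u ∉ Set.range v ∧ u ∉ Set.range w} with hU
  have hW : G.ConnOn (G.comp U u) := connOn_comp
  have hWU : ∀ x ∈ G.comp U u, x ∉ Set.range v ∧ x ∉ Set.range w := fun x hx => by
    have := comp_subset hx; exact this
  obtain ⟨a, ha⟩ := h.att_unique hW (fun x hx => (hWU x hx).1) (fun x hx => (hWU x hx).2)
  obtain ⟨b, hb⟩ := h.symm.att_unique hW (fun x hx => (hWU x hx).2) (fun x hx => (hWU x hx).1)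
  have hmem : u ∈ G.comp U u := mem_comp_self hu
  have h3 := h.cyc.three_le
  obtain ⟨x, hx, y, hy, hxy, h1, h2, -, -⟩ := hG.exists_cross (G.comp U u) (a := v a) (b := w b)
    (y := v (a + 1)) hmem (fun hh => (hWU _ hh).1 ⟨_, rfl⟩) (fun hh => hu.1 ⟨_, hh.symm⟩)
    (fun hh => hu.2 ⟨_, hh.symm⟩) (h.cyc.adj a).ne' (h.ne _ _)
  by_cases hyv : y ∈ Set.range v
  · obtain ⟨i, rfl⟩ := hyv
    exact h1 (ha x hx i hxy)
  by_cases hyw : y ∈ Set.range w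
  · obtain ⟨i, rfl⟩ := hyw
    exact h2 (hb x hx i hxy)
  exact hy (mem_comp_of_adj hx hxy ⟨hyv, hyw⟩)

/-- `v` is chordless, as it spans no even cycle, so a third neighbour of `v i` lies on `w`. -/
theorem exists_cross (h : G.OddPair n k v w) (hG : G.TriConn) (i : ℤ) :
    ∃ j, G.Adj (v i) (w j) := by
  obtain ⟨u, h1, h2, h3⟩ := hG.exists_adj (v i) (v (i + 1)) (v (i - 1))
  rcases h.cover hG u with ⟨j, rfl⟩ | ⟨j, rfl⟩
  · refine ((h.cyc.chordless h.odd ?_ h1).elim h2 h3).elim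
    intro m hm hc
    refine h.no_even' m hm (hc.mono ?_)
    rintro _ ⟨a, rfl⟩ ⟨b, hb⟩
    exact h.ne a b hb.symm
  · exact ⟨j, h1⟩

/-- Along an odd cycle, the attachments to the other cycle cannot agree at every step of `r`. -/
theorem exists_step (h : G.OddPair n k v w) (hG : G.TriConn) {r : ℤ} (hr : r = 1 ∨ r = 2) :
    ∃ i a b, v a ≠ v b ∧ G.Adj (v a) (w i) ∧ G.Adj (v b) (w (i + r)) := by
  -- Otherwise the attachments have period `r` and odd period `k`, so they are constant; but `v 0`
  -- and `v 1` both have neighbours on `w`.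
  by_contra! hcon
  choose c hc using h.symm.exists_cross hG
  have e1 : ∀ i a, G.Adj (v a) (w i) → v a = v (c (i + r)) := fun i a ha =>
    by_contra fun hne => hcon i a _ hne ha (hc _).symm
  have e2 : Function.Periodic (fun i => v (c i)) r := fun i => (e1 i _ (hc i).symm).symm
  have e3 : Function.Periodic (fun i => v (c i)) 2 := by
    rcases hr with rfl | rfl
    · simpa using e2.int_mul 2
    · exact e2
  have e4 : Function.Periodic (fun i => v (c i)) k := fun i => by
    have := e1 i (c (i + k)) (by have := (hc (i + k)).symm; rwa [h.cyc'.period] at this)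
    exact this.trans (e2 i)
  have e5 : ∀ i, v (c i) = v (c 0) := by
    have key : Function.Periodic (fun i => v (c i)) 1 := fun i => by
      have := e3.int_mul ((k - 1) / 2) (i + 1)
      rw [Int.cast_id, show i + 1 + ((k : ℤ) - 1) / 2 * 2 = i + k by have := h.odd'; omega] at this
      exact this.symm.trans (e4 i)
    intro i
    have := key.int_mul i 0
    simpa using this
  obtain ⟨a, ha⟩ := h.exists_cross hG 0
  obtain ⟨b, hb⟩ := h.exists_cross hG 1
  refine (h.cyc.adj 0).ne ?_
  exact (e1 _ _ ha).trans ((e5 _).trans ((e5 _).symm.trans (e1 _ _ hb).symm))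

/-- Steps of length 1 and 2 along `w` close through the triangle to lengths `1 + 3` and `2 + 4`. -/
theorem win_of_triangle (h : G.OddPair 3 k v w) (hG : G.TriConn) : G.Win := by
  have h3 := h.cyc'.three_le
  obtain ⟨i, a, b, hab, ha, hb⟩ := h.exists_step hG (Or.inl rfl)
  obtain ⟨i', a', b', hab', ha', hb'⟩ := h.exists_step hG (Or.inr rfl)
  have hd : ∀ u ∈ Set.range w, u ∉ Set.range v := by
    rintro _ ⟨s, rfl⟩ ⟨t, ht⟩
    exact h.ne t s ht
  have p1 := h.cyc'.arc_range (i := i) (j := i + 1) (by omega) (by omega)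
  have p2 := h.cyc'.arc_range (i := i') (j := i' + 2) (by omega) (by omega)
  have c4 := (h.cyc.triangle_cyc p1 hd hab ha hb).1
  have c6 := (h.cyc.triangle_cyc p2 hd hab' ha' hb').2
  exact win_of_cyc c4 c6 (by omega) (by omega)

end OddPair

/-- A hexagon with three alternate vertices attached to a connected set outside. -/
theorem IsCyc.win_of_hexagon {h : ℤ → V} (hh : G.IsCyc 6 h) {W : Set V} (hW : G.ConnOn W)
    (hd : ∀ i, h i ∉ W) (h0 : G.Att W (h 0)) (h2 : G.Att W (h 2)) (h4 : G.Att W (h 4)) :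
    G.Win := by
  obtain ⟨x, hx, hx'⟩ := h0
  obtain ⟨y, hy, hy'⟩ := h2
  obtain ⟨z, hz, hz'⟩ := h4
  have hne : ∀ i j : ℤ, i < j → j < i + 6 → h i ≠ h j := fun i j h1 h2 e => by
    have := hh.inj _ _ e (by omega) (by omega); omega
  -- Zero labels ask for an even path; two alternate vertices of a hexagon have arcs of lengths 2
  -- and 4.
  obtain ⟨n, hn, hp⟩ := hW.tripod₃ 0 0 0 (hne 0 2 (by omega) (by omega))
    (hne 0 4 (by omega) (by omega)) (hne 2 4 (by omega) (by omega)) (hd 0) (hd 2) (hd 4) hx hy hz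
    hx'.symm hy'.symm hz'.symm
  have hdd : ∀ i j, ∀ u ∈ insert (h i) (insert (h j) W), u ∈ Set.range h → u = h i ∨ u = h j := by
    rintro i j u (hu | hu | hu) hu'
    · exact Or.inl hu
    · exact Or.inr hu
    · obtain ⟨t, rfl⟩ := hu'
      exact (hd t hu).elim
  rcases hp with ⟨hp, hpar⟩ | ⟨hp, hpar⟩ | ⟨hp, hpar⟩
  · exact hp.win (hh.arc_range (i := 0) (j := 2) (by omega) (by omega))
      (hh.arc_range' (i := 0) (j := 2) (by omega) (by omega)) (by omega) (by omega) hn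
      (hne 0 2 (by omega) (by omega)) (hdd 0 2) (hdd 0 2)
  · exact hp.win (hh.arc_range' (i := 0) (j := 4) (by omega) (by omega))
      (hh.arc_range (i := 0) (j := 4) (by omega) (by omega)) (by omega) (by omega) hn
      (hne 0 4 (by omega) (by omega)) (hdd 0 4) (hdd 0 4)
  · exact hp.win (hh.arc_range (i := 2) (j := 4) (by omega) (by omega))
      (hh.arc_range' (i := 2) (j := 4) (by omega) (by omega)) (by omega) (by omega) hn
      (hne 2 4 (by omega) (by omega)) (hdd 2 4) (hdd 2 4)

theorem IsCyc.arc_natAbs {n : ℕ} {v : ℤ → V} (hv : G.IsCyc n v) (i d : ℤ) (hd : d.natAbs < n) :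
    G.PathIn (Set.range v) (v i) (v (i + d)) d.natAbs := by
  rcases le_total 0 d with h | h
  · have := hv.arc_range (i := i) (j := i + d) (by omega) (by omega)
    rwa [show (i + d - i).toNat = d.natAbs by omega] at this
  · have := (hv.arc_range (i := i + d) (j := i) (by omega) (by omega)).symm
    rwa [show (i - (i + d)).toNat = d.natAbs by omega] at this

namespace OddPair

variable {n k : ℕ} {v w : ℤ → V}

/-- If the attachments of two consecutive vertices are at distance three, there is a suitable
hexagon. -/
theorem win_of_distance_three (h : G.OddPair n k v w) (hG : G.TriConn) (h5 : 5 ≤ n)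
    (huniq : ∀ i a b, G.Adj (v a) (w i) → G.Adj (v b) (w i) → v a = v b)
    (h0 : G.Adj (v 0) (w 0)) (h3 : G.Adj (v 3) (w 1)) : G.Win := by
  have hk := h.cyc'.three_le
  have hne : ∀ i j : ℤ, i < j → j < i + n → v i ≠ v j := fun i j h1 h2 e => by
    have := h.cyc.inj _ _ e (by omega) (by omega); omega
  have hwne : ∀ i j : ℤ, i < j → j < i + k → w i ≠ w j := fun i j h1 h2 e => by
    have := h.cyc'.inj _ _ e (by omega) (by omega); omega
  -- neighbours on the second cycle of a vertex other than `v 0` and `v 3`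
  have hnb : ∀ i, v i ≠ v 0 → v i ≠ v 3 → ∃ j : ℤ, 2 ≤ j ∧ j < k ∧ G.Adj (v i) (w j) := by
    intro i hi0 hi3
    obtain ⟨j', hj'⟩ := h.exists_cross hG i
    obtain ⟨j, j1, j2, j3⟩ := h.cyc'.exists_rep 0 j'
    rw [← j3] at hj'
    refine ⟨j, ?_, by omega, hj'⟩
    by_contra hlt
    rcases (show j = 0 ∨ j = 1 by omega) with rfl | rfl
    · exact hi0 (huniq 0 _ _ hj' h0)
    · exact hi3 (huniq 1 _ _ hj' h3)
  -- The hexagon is `w 0, w 1, v 3, v 2, v 1, v 0`, with alternate vertices `w 0, v 3, v 1`. The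
  -- outside set consists of `v 4` and `w 2, …, w (k - 1)`.
  set q : ℕ → V := fun i => if i ≤ 1 then w i else v (5 - i) with hq
  have q0 : q 0 = w 0 := rfl
  have q1 : q 1 = w 1 := rfl
  have q2 : q 2 = v 3 := rfl
  have q3 : q 3 = v 2 := rfl
  have q4 : q 4 = v 1 := rfl
  have q5 : q 5 = v 0 := rfl
  have hcyc : G.IsCyc 6 fun i => q (i % (6 : ℕ)).toNat := by
    refine IsCyc.of_path (by omega) ?_ ?_ (by rw [q5, q0]; exact h0)
    · intro i hi
      rcases (show i = 0 ∨ i = 1 ∨ i = 2 ∨ i = 3 ∨ i = 4 by omega) with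
        rfl | rfl | rfl | rfl | rfl
      · exact h.cyc'.adj 0
      · exact h3.symm
      · exact (h.cyc.adj 2).symm
      · exact (h.cyc.adj 1).symm
      · exact (h.cyc.adj 0).symm
    · intro i hi j hj hij
      simp only [hq] at hij
      split_ifs at hij with h1 h2 h2
      · have := h.cyc'.inj _ _ hij (by omega) (by omega)
        omega
      · exact (h.ne _ _ hij.symm).elim
      · exact (h.ne _ _ hij).elim
      · have := h.cyc.inj _ _ hij (by omega) (by omega)
        omega
  have harc : G.ConnOn (w '' Set.Icc 2 (k - 1)) := by
    have key : ∀ x ∈ w '' Set.Icc 2 (k - 1 : ℤ), G.Reach (w '' Set.Icc 2 (k - 1)) (w 2) x := by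
      rintro _ ⟨t, ⟨t1, t2⟩, rfl⟩
      exact ((h.cyc'.arc' (i := 2) (j := t) t1 (by omega)).mono
        (Set.image_mono (Set.Icc_subset_Icc_right t2))).reach
    exact fun x hx y hy => (key x hx).symm.trans (key y hy)
  obtain ⟨j, j1, j2, hj⟩ := hnb 4 (hne 0 4 (by omega) (by omega)).symm
    (hne 3 4 (by omega) (by omega)).symm
  obtain ⟨l, l1, l2, hl⟩ := hnb 1 (hne 0 1 (by omega) (by omega)).symm
    (hne 1 3 (by omega) (by omega))
  refine hcyc.win_of_hexagon (harc.insert_adj ⟨j, ⟨j1, by omega⟩, rfl⟩ hj.symm) ?_ ?_ ?_ ?_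
  · intro i
    have i1 := Int.emod_nonneg i (b := (6 : ℕ)) (by omega)
    have i2 := Int.emod_lt_of_pos i (b := (6 : ℕ)) (by omega)
    have hm : (i % (6 : ℕ)).toNat ≤ 5 := by omega
    generalize (i % (6 : ℕ)).toNat = m at hm ⊢
    simp only [hq]
    split_ifs with hm1
    · rintro (e | ⟨t, ⟨t1, t2⟩, e⟩)
      · exact h.ne _ _ e.symm
      · exact hwne m t (by omega) (by omega) e.symm
    · rintro (e | ⟨t, ⟨t1, t2⟩, e⟩)
      · exact hne _ 4 (by omega) (by omega) e
      · exact h.ne _ _ e.symm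
  · refine ⟨w (k - 1), Or.inr ⟨_, ⟨by omega, le_rfl⟩, rfl⟩, ?_⟩
    have e1 := h.cyc'.adj (k - 1)
    have e2 := h.cyc'.period 0
    rw [zero_add] at e2
    rwa [sub_add_cancel, e2] at e1
  · exact ⟨v 4, Or.inl rfl, (h.cyc.adj 3).symm⟩
  · exact ⟨w l, Or.inr ⟨l, ⟨l1, by omega⟩, rfl⟩, hl.symm⟩

/-- Two odd cycles, the first of which is a shortest odd cycle and has at least five vertices. -/
theorem win_of_five_le (h : G.OddPair n k v w) (hG : G.TriConn) (h5 : 5 ≤ n)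
    (hmin : ∀ m, m % 2 = 1 → G.CycIn Set.univ m → n ≤ m) : G.Win := by
  by_contra hwin
  have huniq : ∀ i a b, G.Adj (v a) (w i) → G.Adj (v b) (w i) → v a = v b := fun i a b ha hb =>
    hG.eq_of_shortest hwin h.cyc h.odd hmin h5 (fun ⟨j, hj⟩ => h.ne j i hj) ha.symm hb.symm
  have hk : n ≤ k := hmin k h.odd' (h.cyc'.cycIn.mono (Set.subset_univ _))
  have hwne : ∀ i, w i ≠ w (i + 1) := fun i => (h.cyc'.adj i).ne
  -- Equal attachments would give a triangle. Distinct ones give an ear of length three on a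
  -- shortest odd cycle, which spans an arc of length 1 or 3.
  have hstep : ∀ i a, G.Adj (v a) (w i) → ∃ d, G.Adj (v (a + d)) (w (i + 1)) ∧
      (d.natAbs = 1 ∨ d.natAbs = 3) := by
    intro i a ha
    obtain ⟨b, hb⟩ := h.symm.exists_cross hG (i + 1)
    have hab : v a ≠ v b := by
      intro e
      rw [← e] at hb
      have := hmin 3 rfl (((PathIn.of_two ha (h.cyc'.adj i) (h.ne _ _)).closeAdj hb.symm
        le_rfl).mono (Set.subset_univ _))
      omega
    obtain ⟨c, c1, c2, c3⟩ := h.cyc.exists_lt_rep hab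
    rw [← c3] at hb hab
    have hp := (PathIn.of_one (h.cyc'.adj i)).ends ha hb.symm hab (by
      rintro (e | e) <;> exact h.ne _ _ e) (by
      rintro (e | e) <;> exact h.ne _ _ e)
    have := h.cyc.le_of_ear h.odd hmin c1 c2 hp (by
      rintro u (e | e | e | e) ⟨t, ht⟩
      · exact Or.inl e
      · exact Or.inr e
      · exact (h.ne _ _ (ht.trans e)).elim
      · exact (h.ne _ _ (ht.trans e)).elim)
    have hh := h.odd
    rcases (show c = a + 1 ∨ c = a + 3 ∨ c = a + -1 + n ∨ c = a + -3 + n by omega) with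
      rfl | rfl | rfl | rfl
    · exact ⟨1, hb.symm, Or.inl rfl⟩
    · exact ⟨3, hb.symm, Or.inr rfl⟩
    · rw [h.cyc.period] at hb
      exact ⟨-1, hb.symm, Or.inl rfl⟩
    · rw [h.cyc.period] at hb
      exact ⟨-3, hb.symm, Or.inr rfl⟩
  have hcyc : ∀ i a d, G.Adj (v a) (w i) → G.Adj (v (a + d)) (w (i + 1)) → d.natAbs < n →
      G.CycIn Set.univ (d.natAbs + 1 + 2) := by
    intro i a d ha hd hdn
    refine IsCyc.cross_cycle h.ne subset_rfl subset_rfl (h.cyc.arc_natAbs a d hdn)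
      (h.cyc'.arc_natAbs i 1 (by omega)) ha hd (by omega)
  obtain ⟨a₀, ha₀⟩ := h.symm.exists_cross hG 0
  replace ha₀ := ha₀.symm
  obtain ⟨d, hd, hd'⟩ := hstep 0 a₀ ha₀
  obtain ⟨e, he, he'⟩ := hstep _ _ hd
  have cd := hcyc _ _ _ ha₀ hd (by omega)
  have ce := hcyc _ _ _ hd he (by omega)
  -- A step with offset `d` closes to a cycle of length `|d| + 3`, so offsets of sizes 1 and 3
  -- together give lengths 4 and 6.
  rcases hd' with d1 | d3
  · have c4 : G.CycIn Set.univ 4 := by rwa [d1] at cd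
    rcases he' with e1 | e3
    -- Opposite unit offsets make `v a₀` a common neighbour of `w 0` and `w 2`; equal ones close
    -- arcs of length two on both cycles to a 6-cycle.
    · by_cases hde : d + e = 0
      · rw [add_assoc, hde, add_zero] at he
        exact hwin (hG.win_of_common_nbr h.cyc' h.odd' (by omega) (x := v a₀) (i := 0)
          (fun ⟨j, hj⟩ => h.ne _ _ hj.symm) ha₀ he)
      · have hp := h.cyc.arc_natAbs a₀ (d + e) (by omega)
        rw [← add_assoc] at hp
        have c6 := IsCyc.cross_cycle h.ne subset_rfl subset_rfl hp
          (h.cyc'.arc_natAbs 0 2 (by omega)) ha₀ he (by omega)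
        exact hwin (win_of_cyc c4 c6 (by omega) rfl)
    · exact hwin (win_of_cyc c4 ce (by omega) rfl)
  · rcases he' with e1 | e3
    · exact hwin (win_of_cyc ce cd (by omega) (by omega))
    -- The first offset alone suffices; `-3` becomes `3` by reversing `v`.
    · rcases (show d = 3 ∨ d = -3 by omega) with rfl | rfl
      · refine hwin ((h.shift a₀ 0).win_of_distance_three hG h5 ?_ ?_ ?_)
        · exact fun i a b => huniq _ _ _
        · simpa using ha₀
        · simpa [add_comm] using hd
      · refine hwin ((h.neg.shift (-a₀) 0).win_of_distance_three hG h5 ?_ ?_ ?_)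
        · exact fun i a b => huniq _ _ _
        · simpa using ha₀
        · rw [show -(3 + -a₀) = a₀ + -3 by ring]
          simpa using hd

end OddPair

/-! ### The case distinction on a shortest odd cycle -/

theorem TriConn.win [Finite V] (hG : G.TriConn) : G.Win := by
  by_contra hwin
  by_cases hodd : ∃ n, n % 2 = 1 ∧ G.CycIn Set.univ n
  swap
  · push Not at hodd
    exact hwin (hG.win_of_bipartite hodd)
  classical
  obtain ⟨hn, hc⟩ := Nat.find_spec hodd
  have hmin : ∀ m, m % 2 = 1 → G.CycIn Set.univ m → Nat.find hodd ≤ m := fun m h1 h2 =>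
    Nat.find_min' hodd ⟨h1, h2⟩
  generalize Nat.find hodd = n at *
  obtain ⟨v, hv, -⟩ := hc.exists_isCyc
  have h3 := hv.three_le
  have hF : ∃ k, G.CycIn (Set.range v)ᶜ k := by
    by_cases h5 : 5 ≤ n
    · exact hG.exists_cycIn_compl hwin hv hn hmin h5
    · obtain rfl : n = 3 := by omega
      by_contra! hac
      exact hwin (hG.win_of_triangle_acyclic hv hac)
  obtain ⟨k, hk⟩ := hF
  have hev : ∀ m, m % 2 = 0 → ¬ G.CycIn (Set.range v)ᶜ m := fun m hm hcm =>
    hwin (hG.win_of_disjoint hv hn hm hcm)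
  have hk1 : k % 2 = 1 := by
    by_contra h
    exact hev k (by omega) hk
  obtain ⟨w, hw, hwv⟩ := hk.exists_isCyc
  have hp : G.OddPair n k v w := ⟨hv, hw, hn, hk1, fun i j h => hwv ⟨j, rfl⟩ ⟨i, h⟩, hev,
    fun m hm hcm => hwin (hG.win_of_disjoint hw hk1 hm hcm)⟩
  by_cases h5 : 5 ≤ n
  · exact hwin (hp.win_of_five_le hG h5 hmin)
  · obtain rfl : n = 3 := by omega
    exact hwin (hp.win_of_triangle hG)

end SimpleGraph

theorem theorem1p6 {V : Type*} [Fintype V] (G : SimpleGraph V)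
    (h3 : G.IsKConnected 3) (hV : 6 ≤ Fintype.card V) :
    G.HasConsecutiveEvenCycles :=
  (h3.triConn hV).win.hasConsecutiveEvenCycles
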